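/- Infinite draughts is played on the dark squares $\{(x,y)\in\mathbb{Z}^2 : x+y \text{ even}\}$ of an infinite board. A position consists of an arrangement of (possibly infinitely many) red and black pawns and kings on dark squares, together with the player, Red or Black, whose turn it is. A piece moves diagonally by one square to an empty square, or jumps diagonally over an adjacent enemy piece to the empty square just beyond, the jumped piece being removed from the board immediately; kings may do this in all four diagonal directions, black pawns only upward and red pawns only downward, and there is no promotion. On one turn a single piece may make several jumps in succession; it may even make infinitely many, in which case all the jumped pieces, and also the jumping piece itself, are removed from the board. Forced-jump rule: a player who can jump an enemy piece must make a jumping move. The forced-iterated-jump rule is not in force: after the first jump of a turn, the player may stop at any point of the iterated jump, even if further jumps are possible. A player who is to move but has no legal move loses, and the other player wins; infinite play is a draw. The game value (for Red) of a position is defined by transfinite recursion. A position already won for Red has value $0$. A position not yet won with Red to move has value $\alpha+1$, where $\alpha$ is the least value of a position to which Red can legally move, if there is one. A position with Black to move has as its value the supremum of the values of the positions to which Black can legally move, provided that all of these have a value; otherwise it has no value. **Theorem.** In the version of infinite draughts with the forced-jump rule, but without the forced-iterated-jump rule, every countable ordinal is the game value (for Red) of some position. -/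

import Mathlib

open scoped Cardinal

namespace Draughts

/-- The two players, who own the pieces of their colour and move alternately. -/
inductive Player
  | red
  | black
  deriving DecidableEq

/-- The opponent of a player. -/
def Player.other : Player → Player
  | .red => .black
  | .black => .red

/-- Pieces are pawns or kings. -/
inductive Rank
  | pawn
  | king
  deriving DecidableEq

/-- A piece: its owner and its rank. There is no promotion on the infinite board. -/
structure Piece where
  owner : Player
  rank : Rank
  deriving DecidableEq

/-- Squares of the infinite board, as (column, row). -/
abbrev Square := ℤ × ℤ

/-- The dark squares. -/
def Square.Dark (s : Square) : Prop := Even (s.1 + s.2)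

/-- An arrangement of (possibly infinitely many) pieces on the board. -/
abbrev Board := Square → Option Piece

/-- A position: an arrangement of pieces, and the player whose turn it is. -/
structure Position where
  board : Board
  turn : Player

/-- All pieces stand on dark squares (moves are diagonal, so this is preserved by play). -/
def Position.OnDarkSquares (X : Position) : Prop :=
  ∀ s, X.board s ≠ none → Square.Dark s

/-- The vertical direction in which the pawns of a player travel: black up, red down. -/
def Player.forward : Player → ℤ
  | .red => -1
  | .black => 1

/-- `d` is a diagonal unit direction in which the piece may move or jump:
kings in all four diagonal directions, pawns only forward. -/
def Piece.CanGo (p : Piece) (d : Square) : Prop :=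
  (d.1 = 1 ∨ d.1 = -1) ∧ (d.2 = 1 ∨ d.2 = -1) ∧
    (p.rank = Rank.pawn → d.2 = p.owner.forward)

/-- `SimpleStep B s B'`: the piece on `s` moves, without capture, to an adjacent empty square,
which turns the arrangement `B` into `B'`. -/
def SimpleStep (B : Board) (s : Square) (B' : Board) : Prop :=
  ∃ (p : Piece) (d : Square), B s = some p ∧ p.CanGo d ∧ B (s + d) = none ∧
    B' = Function.update (Function.update B s none) (s + d) (some p)

/-- `JumpStep (B, s) (B', t)`: in `B`, the piece on `s` makes a single jump over an adjacent enemy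
piece to the empty square `t` just beyond; the enemy piece is removed at once, giving `B'`. -/
def JumpStep (a b : Board × Square) : Prop :=
  ∃ (p q : Piece) (d : Square), a.1 a.2 = some p ∧ p.CanGo d ∧
    a.1 (a.2 + d) = some q ∧ q.owner ≠ p.owner ∧ a.1 (a.2 + d + d) = none ∧
    b.2 = a.2 + d + d ∧
    b.1 = Function.update (Function.update (Function.update a.1 a.2 none) (a.2 + d) none)
      (a.2 + d + d) (some p)

/-- A finite iterated jump with the piece on `s`: one or more single jumps in succession,
which may be stopped after any of them, even if a further jump is possible. -/
def FiniteJump (B : Board) (s : Square) (B' : Board) : Prop :=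
  ∃ t : Square, Relation.TransGen JumpStep (B, s) (B', t)

/-- An infinite iterated jump with the piece on `s`: an infinite succession of single jumps, after
which the captured pieces and also the jumping piece itself are gone. The pieces that remain are
those whose squares have never been vacated during the process. -/
def InfiniteJump (B : Board) (s : Square) (B' : Board) : Prop :=
  ∃ f : ℕ → Board × Square, f 0 = (B, s) ∧ (∀ n, JumpStep (f n) (f (n + 1))) ∧
    ∀ t, ((∃ n, (f n).1 t = none) → B' t = none) ∧ ((∀ n, (f n).1 t ≠ none) → B' t = B t)

namespace Position

/-- The square `s` holds a piece of the player whose turn it is. -/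
def Movable (X : Position) (s : Square) : Prop :=
  ∃ p : Piece, X.board s = some p ∧ p.owner = X.turn

/-- The player whose turn it is can jump an enemy piece. -/
def CanJump (X : Position) : Prop :=
  ∃ s, X.Movable s ∧ ∃ b, JumpStep (X.board, s) b

/-- A legal move, with the forced-jump rule, but without the forced-iterated-jump rule:
if a jump is possible, the move must be a finite or infinite iterated jump with one piece, otherwise
it is a simple move. The turn then passes to the other player. -/
def LegalMove (X Y : Position) : Prop :=
  Y.turn = X.turn.other ∧ ∃ s, X.Movable s ∧
    ((X.CanJump ∧ (FiniteJump X.board s Y.board ∨ InfiniteJump X.board s Y.board)) ∨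
      (¬ X.CanJump ∧ SimpleStep X.board s Y.board))

/-- The player `P` has won: it is the turn of the opponent, who has no legal move. -/
def WonBy (X : Position) (P : Player) : Prop :=
  X.turn = P.other ∧ ∀ Y, ¬ X.LegalMove Y

lemma eq_other_of_ne {P Q : Player} (h : ¬ Q = P) : Q.other = P := by
  cases P <;> cases Q <;> simp_all [Player.other]

open Classical in
/-- `X.HasGameValue P α`: the position `X` has game value `α` for the (open) player `P`.
This is the transfinite recursion on `α` (with, for the same `α`, the positions with `P` to move
first):
* a position won by `P` has value `0`;
* otherwise, with `P` to move, the value is `β + 1`, where `β` is the least value of a position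
  to which `P` can move;
* otherwise, with the opponent to move, all positions to which a legal move can be made must have
  a value, and the value is the supremum of these values. -/
noncomputable def HasGameValue (P : Player) (α : Ordinal.{0}) (X : Position) : Prop :=
  if X.WonBy P then α = 0
  else if _hP : X.turn = P then
    ∃ β, ∃ _hβ : α = β + 1,
      (∃ Y, X.LegalMove Y ∧ HasGameValue P β Y) ∧
      ∀ γ, ∀ _hγ : γ < β, ∀ Y, X.LegalMove Y → ¬ HasGameValue P γ Y
  else
    (∀ Y, ∀ _hY : X.LegalMove Y, ∃ β, ∃ _hβ : β ≤ α, HasGameValue P β Y) ∧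
    (∀ δ, δ < α → ∃ Y, ∃ _hY : X.LegalMove Y, ∃ β, ∃ _hβ : β ≤ α, δ < β ∧ HasGameValue P β Y)
termination_by (α, if X.turn = P then 0 else 1)
decreasing_by
  · exact Prod.Lex.left _ _ (by rw [_hβ]; exact lt_add_one β)
  · exact Prod.Lex.left _ _ (_hγ.trans (by rw [_hβ]; exact lt_add_one β))
  all_goals
    rcases _hβ.lt_or_eq with h | h
    · exact Prod.Lex.left _ _ h
    · subst h
      refine Prod.Lex.right _ ?_
      rw [if_neg _hP, if_pos (_hY.1.trans (eq_other_of_ne _hP))]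
      exact Nat.one_pos

/-- First clause of the definition of game values. -/
theorem hasGameValue_of_won {P : Player} {X : Position} (h : X.WonBy P) (α : Ordinal.{0}) :
    HasGameValue P α X ↔ α = 0 := by
  rw [HasGameValue, if_pos h]

lemma not_wonBy_of_turn {P : Player} {X : Position} (hP : X.turn = P) : ¬ X.WonBy P := by
  rintro ⟨h, -⟩
  rw [hP] at h
  cases P <;> simp [Player.other] at h

/-- Second clause of the definition of game values: the player's own turn. -/
theorem hasGameValue_of_own_turn {P : Player} {X : Position} (hP : X.turn = P)
    (α : Ordinal.{0}) :
    HasGameValue P α X ↔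
      ∃ β, IsLeast {γ | ∃ Y, X.LegalMove Y ∧ HasGameValue P γ Y} β ∧ α = β + 1 := by
  rw [HasGameValue, if_neg (not_wonBy_of_turn hP), dif_pos hP]
  constructor
  · rintro ⟨β, rfl, h1, h2⟩
    refine ⟨β, ⟨h1, ?_⟩, rfl⟩
    rintro γ ⟨Y, hY, hv⟩
    by_contra hlt
    exact h2 γ (not_le.1 hlt) Y hY hv
  · rintro ⟨β, ⟨h1, h2⟩, rfl⟩
    exact ⟨β, rfl, h1, fun γ hγ Y hY hv => absurd (h2 ⟨Y, hY, hv⟩) (not_le.2 hγ)⟩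

lemma hasGameValue_unique_own {P : Player} {X : Position} (hP : X.turn = P) {α β : Ordinal.{0}}
    (ha : HasGameValue P α X) (hb : HasGameValue P β X) : α = β := by
  obtain ⟨a, ha', rfl⟩ := (hasGameValue_of_own_turn hP _).1 ha
  obtain ⟨b, hb', rfl⟩ := (hasGameValue_of_own_turn hP _).1 hb
  rw [ha'.unique hb']

/-- Third clause of the definition of game values: the turn of the opponent. (If the opponent has no
legal move, this gives the value `0` of a won position.) -/
theorem hasGameValue_of_opponent_turn {P : Player} {X : Position} (hP : X.turn ≠ P)
    (α : Ordinal.{0}) :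
    HasGameValue P α X ↔
      (∀ Y, X.LegalMove Y → ∃ β, HasGameValue P β Y) ∧
        IsLUB {β | ∃ Y, X.LegalMove Y ∧ HasGameValue P β Y} α := by
  by_cases hw : X.WonBy P
  · rw [hasGameValue_of_won hw]
    have he : {β | ∃ Y, X.LegalMove Y ∧ HasGameValue P β Y} = ∅ := by
      ext β
      simp only [Set.mem_ofPred_eq, Set.mem_empty_iff_false, iff_false]
      rintro ⟨Y, hY, -⟩
      exact hw.2 Y hY
    rw [he, isLUB_empty_iff]
    constructor
    · rintro rfl
      exact ⟨fun Y hY => absurd hY (hw.2 Y), fun a => bot_le⟩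
    · rintro ⟨-, h⟩
      exact le_antisymm (h 0) bot_le
  · have hu : ∀ Y, X.LegalMove Y → ∀ a b, HasGameValue P a Y → HasGameValue P b Y → a = b :=
      fun Y hY a b => hasGameValue_unique_own (hY.1.trans (eq_other_of_ne hP))
    rw [HasGameValue, if_neg hw, dif_neg hP]
    constructor
    · rintro ⟨h1, h2⟩
      refine ⟨fun Y hY => ?_, ?_, ?_⟩
      · obtain ⟨β, -, h⟩ := h1 Y hY
        exact ⟨β, h⟩
      · rintro γ ⟨Y, hY, hv⟩
        obtain ⟨β, hβ, h⟩ := h1 Y hY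
        rw [hu Y hY γ β hv h]
        exact hβ
      · intro δ hδ
        by_contra hlt
        obtain ⟨Y, hY, β, -, hlt', h⟩ := h2 δ (not_le.1 hlt)
        exact absurd (hδ ⟨Y, hY, h⟩) (not_le.2 hlt')
    · rintro ⟨h1, h2⟩
      refine ⟨fun Y hY => ?_, fun δ hδ => ?_⟩
      · obtain ⟨β, h⟩ := h1 Y hY
        exact ⟨β, h2.1 ⟨Y, hY, h⟩, h⟩
      · obtain ⟨β, ⟨Y, hY, h⟩, hlt⟩ := (lt_isLUB_iff h2).1 hδ
        exact ⟨Y, hY, β, h2.1 ⟨Y, hY, h⟩, hlt, h⟩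

end Position

end Draughts

/-! The position is a network of tracks, each owned by a waiting black pawn that is blocked until
one red pawn, its gate, disappears. Once the gate is open, the pawn must jump along its track. It
may stop after any jump, because iterated jumps are not forced. The red pawn just beyond the
stopping square then has to capture it, and this capture vacates the square of the capturing pawn.
If that square is a gate, the next track opens and Black goes on; otherwise every black pawn is
stuck and Red has won. So Black's only real choice is where to stop. If Black jumps forever, the
jumping pawn vanishes, Red makes a quiet move, and again Black is stuck.

Take ordinals `f 0 = α, f 1, ...` such that every ordinal below `f r` occurs again after `r`
(`exists_ordinal_sequence`), and one track for each row `r`. Row `r` runs to infinity and meets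
every column `k > r`; the exit there is armed exactly when `f k < f r`. An armed exit leads up
column `k`, around a bend and into row `k`. Each passage to a new row lowers the label, so the
network is well-founded and Red wins (`Ready.valued`). On the other hand Black can move to a row
with any prescribed smaller label, and on these lines Red's replies are forced, so the value of row
`r` is at least `f r` (`Ready.atLeast`).

The detours through exits, columns and bends cost extra moves, so the value at row `0` need not be
`α` itself. This is harmless: the ordinals below the value of a position are themselves values
(`exists_of_le_value`). It remains to check the geometry, which `Network` isolates as a list of
local conditions and `Track.network` verifies in coordinates. -/

namespace Draughts
namespace Position

/-! ### Bounds for game values, and values below a given one -/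

/-- Red can force a win from `X`. -/
def Valued (X : Position) : Prop := ∃ α, HasGameValue .red α X

/-- The value of `X`, if there is one, is at least `α`. -/
def AtLeast (α : Ordinal.{0}) (X : Position) : Prop := ∀ γ, HasGameValue .red γ X → α ≤ γ

lemma valued_of_red {X Y : Position} (hX : X.turn = .red) (h : X.LegalMove Y) (hY : Y.Valued) :
    X.Valued := by
  obtain ⟨γ, hγ⟩ := hY
  have hne : {γ | ∃ Y, X.LegalMove Y ∧ HasGameValue .red γ Y}.Nonempty := ⟨γ, Y, h, hγ⟩
  exact ⟨_, (hasGameValue_of_own_turn hX _).2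
    ⟨_, ⟨csInf_mem hne, fun _ hb => csInf_le' hb⟩, rfl⟩⟩

lemma valued_of_black {X : Position} (hX : X.turn = .black)
    (h : ∀ Y, X.LegalMove Y → Y.Valued) : X.Valued := by
  have hX' : X.turn ≠ .red := by simp [hX]
  -- Values of positions with Red to move are unique, so the values of the options form the range of
  -- `v`, which is small and hence bounded.
  choose v hv using fun Y : {Y // X.LegalMove Y} => h Y.1 Y.2
  have hS : {β | ∃ Y, X.LegalMove Y ∧ HasGameValue .red β Y} = Set.range v := by
    ext β
    constructor
    · rintro ⟨Y, hY, hb⟩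
      exact ⟨⟨Y, hY⟩, hasGameValue_unique_own (by rw [hY.1, hX]; rfl) (hv ⟨Y, hY⟩) hb⟩
    · rintro ⟨Y, rfl⟩
      exact ⟨Y.1, Y.2, hv Y⟩
  refine ⟨sSup (Set.range v), (hasGameValue_of_opponent_turn hX' _).2 ⟨h, ?_⟩⟩
  rw [hS]
  exact isLUB_csSup' (Ordinal.bddAbove_of_small)

lemma valued_of_won {X : Position} (h : X.WonBy .red) : X.Valued :=
  ⟨0, (hasGameValue_of_won h 0).2 rfl⟩

lemma atLeast_of_red {X : Position} {α : Ordinal.{0}} (hX : X.turn = .red)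
    (h : ∀ Y, X.LegalMove Y → Y.AtLeast α) : X.AtLeast (α + 1) := by
  intro γ hγ
  obtain ⟨β, ⟨⟨Y, hY, hb⟩, -⟩, rfl⟩ := (hasGameValue_of_own_turn hX _).1 hγ
  gcongr
  exact h Y hY β hb

/-- The `δ + 1` is what `atLeast_of_red` supplies: Red's reply adds one to a bound `δ`. -/
lemma atLeast_of_black {X : Position} {α : Ordinal.{0}} (hX : X.turn = .black)
    (h : ∀ δ < α, ∃ Y, X.LegalMove Y ∧ Y.AtLeast (δ + 1)) : X.AtLeast α := by
  intro γ hγ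
  have hX' : X.turn ≠ .red := by simp [hX]
  obtain ⟨h1, h2⟩ := (hasGameValue_of_opponent_turn hX' _).1 hγ
  by_contra! hlt
  obtain ⟨Y, hY, hl⟩ := h γ hlt
  obtain ⟨β, hb⟩ := h1 Y hY
  exact absurd ((hl β hb).trans (h2.1 ⟨Y, hY, hb⟩)) (not_le.2 (lt_add_one γ))

lemma jumpStep_dark {a b : Board × Square} (h : JumpStep a b)
    (ha : ∀ s, a.1 s ≠ none → Square.Dark s) : ∀ s, b.1 s ≠ none → Square.Dark s := by
  obtain ⟨p, q, d, h1, hd, -, -, -, -, hb⟩ := h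
  intro s hs
  have h0 : Square.Dark a.2 := ha _ (by simp [h1])
  rw [hb] at hs
  by_cases e1 : s = a.2 + d + d
  · subst e1
    have : (a.2 + d + d).1 + (a.2 + d + d).2 = (a.2.1 + a.2.2) + 2 * (d.1 + d.2) := by
      simp only [Prod.fst_add, Prod.snd_add]; ring
    unfold Square.Dark at *
    rw [this]
    exact h0.add (even_two_mul _)
  · rw [Function.update_of_ne e1] at hs
    by_cases e2 : s = a.2 + d
    · simp [e2] at hs
    · rw [Function.update_of_ne e2] at hs
      by_cases e3 : s = a.2
      · exact e3 ▸ h0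
      · rw [Function.update_of_ne e3] at hs
        exact ha s hs

lemma OnDarkSquares.legalMove {X Y : Position} (hX : X.OnDarkSquares) (h : X.LegalMove Y) :
    Y.OnDarkSquares := by
  obtain ⟨-, s, -, ⟨-, ⟨t, ht⟩ | ⟨f, h0, hf, hB⟩⟩ | ⟨-, p, d, h1, hd, -, hB⟩⟩ := h
  · have key : ∀ b : Board × Square, Relation.TransGen JumpStep (X.board, s) b →
        ∀ s, b.1 s ≠ none → Square.Dark s := by
      intro b hb
      induction hb with
      | single hb => exact jumpStep_dark hb hX
      | tail _ hb ih => exact jumpStep_dark hb ih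
    exact key _ ht
  · intro t ht
    have hn : ∀ n, (f n).1 t ≠ none := fun n hn => ht ((hB t).1 ⟨n, hn⟩)
    rw [(hB t).2 hn] at ht
    exact hX t ht
  · intro t ht
    rw [hB] at ht
    have h0 : Square.Dark s := hX _ (by simp [h1])
    by_cases e1 : t = s + d
    · subst e1
      unfold Square.Dark at *
      have : (s + d).1 + (s + d).2 = (s.1 + s.2) + (d.1 + d.2) := by
        simp only [Prod.fst_add, Prod.snd_add]; ring
      rw [this]
      refine h0.add ?_
      rcases hd with ⟨a | a, b | b, -⟩ <;> rw [a, b] <;> decide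
    · rw [Function.update_of_ne e1] at ht
      by_cases e3 : t = s
      · exact e3 ▸ h0
      · rw [Function.update_of_ne e3] at ht
        exact hX t ht

/-- The values of the positions that can arise from a position form an initial segment. -/
lemma exists_of_le_value (γ : Ordinal.{0}) : ∀ X : Position, X.OnDarkSquares →
    HasGameValue .red γ X → ∀ α ≤ γ, ∃ Y : Position, Y.OnDarkSquares ∧ HasGameValue .red α Y := by
  induction γ using WellFoundedLT.induction with
  | _ γ ih =>
  -- `β = γ` must be allowed: a supremum at a black position may be attained by a red option. A red
  -- position then has a successor value, and its best option has a strictly smaller one, to which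
  -- the induction applies.
  have hred : ∀ β ≤ γ, ∀ X : Position, X.turn = .red → X.OnDarkSquares → HasGameValue .red β X →
      ∀ α ≤ β, ∃ Y : Position, Y.OnDarkSquares ∧ HasGameValue .red α Y := by
    intro β hβ X hX hd hv α hα
    rcases hα.eq_or_lt with rfl | hlt
    · exact ⟨X, hd, hv⟩
    · obtain ⟨b, ⟨⟨Y, hY, hb⟩, -⟩, rfl⟩ := (hasGameValue_of_own_turn hX _).1 hv
      exact ih b ((lt_add_one b).trans_le hβ) Y (hd.legalMove hY) hb α (Order.lt_add_one_iff.1 hlt)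
  intro X hd hv α hα
  by_cases hX : X.turn = .red
  · exact hred γ le_rfl X hX hd hv α hα
  rcases hα.eq_or_lt with rfl | hlt
  · exact ⟨X, hd, hv⟩
  obtain ⟨-, h2⟩ := (hasGameValue_of_opponent_turn hX _).1 hv
  obtain ⟨β, ⟨Y, hY, hb⟩, hl⟩ := (lt_isLUB_iff h2).1 hlt
  exact hred β (h2.1 ⟨Y, hY, hb⟩) Y (hY.1.trans (eq_other_of_ne hX)) (hd.legalMove hY) hb α hl.le

end Position
-- Pawns and their directions
/-- A red pawn. -/
abbrev redPawn : Piece := ⟨.red, .pawn⟩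

/-- A black pawn. -/
abbrev blackPawn : Piece := ⟨.black, .pawn⟩

/-- The two directions in which black pawns travel. -/
def IsUp (e : Square) : Prop := e = (1, 1) ∨ e = (-1, 1)

lemma IsUp.snd {e : Square} (h : IsUp e) : e.2 = 1 := by
  rcases h with rfl | rfl <;> rfl

lemma IsUp.canGo_black {e : Square} (h : IsUp e) : blackPawn.CanGo e := by
  rcases h with rfl | rfl <;> simp [Piece.CanGo, Player.forward]

lemma IsUp.canGo_red {e : Square} (h : IsUp e) : redPawn.CanGo (-e) := by
  rcases h with rfl | rfl <;> simp [Piece.CanGo, Player.forward]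

lemma isUp_of_canGo_black {e : Square} (h : blackPawn.CanGo e) : IsUp e := by
  obtain ⟨h1, -, h3⟩ := h
  have h3 := h3 rfl
  simp only [Player.forward] at h3
  rcases h1 with h1 | h1
  · exact .inl (Prod.ext h1 h3)
  · exact .inr (Prod.ext h1 h3)

lemma isUp_of_canGo_red {e : Square} (h : redPawn.CanGo e) : IsUp (-e) := by
  obtain ⟨h1, -, h3⟩ := h
  have h3 := h3 rfl
  simp only [Player.forward] at h3
  rcases h1 with h1 | h1
  · exact .inr (Prod.ext (by simp [h1]) (by simp [h3]))
  · exact .inl (Prod.ext (by simp [h1]) (by simp [h3]))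

lemma eq_of_add_self_eq {e d : Square} (h : e + e = d + d) : e = d := by
  have h1 := congrArg Prod.fst h
  have h2 := congrArg Prod.snd h
  simp only [Prod.fst_add, Prod.snd_add] at h1 h2
  exact Prod.ext (by omega) (by omega)

/-- The squares around `b` that have to be occupied in order that a black pawn on `b` can neither
move nor be jumped by a red pawn. -/
def IsGuard (b g : Square) : Prop := ∃ e, IsUp e ∧ (g = b + e ∨ g = b + e + e ∨ g = b - e)

/-! ### Abstract networks of tracks -/

/-- A network of tracks. Each track `t` belongs to a black pawn, which waits on `p t 0` until its
gate `p t 1` is vacated, and which can then jump along the squares `p t k`. The relation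
`Next t k t'` says that the red pawn capturing the black pawn on `p t (k + 1)` opens the gate of
the track `t'`. The squares of `Z t` have to be in their original state for the use of `t`. -/
structure Network where
  T : Type
  B : Board
  p : T → ℕ → Square
  d : T → ℕ → Square
  ok : T → ℕ → Prop
  Z : T → Set Square
  Next : T → ℕ → T → Prop
  up : ∀ t k, IsUp (d t k)
  p_succ : ∀ t k, p t (k + 1) = p t k + d t k + d t k
  ok_zero : ∀ t, ok t 0
  ok_of_succ : ∀ t k, ok t (k + 1) → ok t k
  typed : ∀ s, B s = none ∨ B s = some redPawn ∨ ∃ t, s = p t 0 ∧ B s = some blackPawn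
  start : ∀ t, p t 0 ∈ Z t ∧ B (p t 0) = some blackPawn
  mid : ∀ t k, ok t k → p t k + d t k ∈ Z t ∧ B (p t k + d t k) = some redPawn
  -- The landing squares begin at index 2, since `p t 1` is the gate and is occupied at first.
  land : ∀ t k, ok t (k + 1) → p t (k + 2) ∈ Z t ∧ B (p t (k + 2)) = none
  head : ∀ t k, ok t k → p t (k + 1) + d t k ∈ Z t ∧ B (p t (k + 1) + d t k) = some redPawn
  -- At every square the pawn can reach, any jump off the track or past its end is blocked by an
  -- occupied landing square.
  side : ∀ t k e, (∀ i < k, ok t i) → IsUp e → (e ≠ d t k ∨ ¬ ok t k) →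
    p t k + e + e ∈ Z t ∧ B (p t k + e + e) ≠ none
  guard : ∀ t g, IsGuard (p t 0) g → B g ≠ none
  -- Of the squares emptied by the use of a track, only that of the capturing pawn may guard another
  -- waiting pawn, and then it is a gate.
  sep_start : ∀ t t', t ≠ t' → ¬ IsGuard (p t' 0) (p t 0)
  sep_gate : ∀ t t', t ≠ t' → ¬ IsGuard (p t' 0) (p t 1)
  sep_mid : ∀ t t' k, t ≠ t' → ok t k → ¬ IsGuard (p t' 0) (p t k + d t k)
  sep_head : ∀ t t' k, t ≠ t' → ok t k → IsGuard (p t' 0) (p t (k + 1) + d t k) → Next t k t'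
  next_ok : ∀ t k t', Next t k t' → ok t k
  next_gate : ∀ t k t', Next t k t' → p t' 1 = p t (k + 1) + d t k
  next_zone : ∀ t k t', Next t k t' → ∀ s ∈ Z t', s ≠ p t' 1 →
    s ∈ Z t ∧ s ≠ p t 0 ∧ s ≠ p t 1 ∧ s ≠ p t (k + 1) ∧ ∀ i ≤ k, s ≠ p t i + d t i
  -- A red pawn on the other upper neighbour of the stopping square cannot capture, its landing
  -- square being occupied; this makes Red's reply unique.
  next_unique : ∀ t k t' e, Next t k t' → IsUp e → e ≠ d t k →
    p t (k + 1) - e ∈ Z t ∧ B (p t (k + 1) - e) ≠ none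
  -- This provides Red's quiet move after an infinite jump: a red pawn that has not been jumped and
  -- is no gate steps down onto an empty landing square.
  spare : ∀ t, (∀ k, ok t k) →
    ∃ k, (∀ t', ¬ Next t k t') ∧ ∀ i, p t (k + 1) + d t k ≠ p t i + d t i
  wf : WellFounded fun t' t => ∃ k, Next t k t'

namespace Network

variable {N : Network}

lemma p_snd (t : N.T) (k : ℕ) : (N.p t k).2 = (N.p t 0).2 + 2 * k := by
  induction k with
  | zero => simp
  | succ k ih =>
    rw [N.p_succ, Prod.snd_add, Prod.snd_add, ih, (N.up t k).snd]
    push_cast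
    ring

lemma mid_snd (t : N.T) (k : ℕ) : (N.p t k + N.d t k).2 = (N.p t 0).2 + 2 * k + 1 := by
  rw [Prod.snd_add, N.p_snd, (N.up t k).snd]

lemma head_snd (t : N.T) (k : ℕ) : (N.p t (k + 1) + N.d t k).2 = (N.p t 0).2 + 2 * k + 3 := by
  rw [Prod.snd_add, N.p_snd, (N.up t k).snd]
  push_cast
  ring

lemma ne_of_snd {a b : Square} (h : a.2 ≠ b.2) : a ≠ b := fun e => h (by rw [e])

lemma ok_le {t : N.T} {i k : ℕ} (h : N.ok t k) (hi : i ≤ k) : N.ok t i := by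
  induction k with
  | zero => obtain rfl : i = 0 := by omega
            exact h
  | succ k ih =>
    rcases hi.eq_or_lt with rfl | hlt
    · exact h
    · exact ih (N.ok_of_succ t k h) (by omega)

/-- The only black pieces are pawns waiting at the beginning of a track, and the only red pieces are
pawns. -/
def Typed (N : Network) (B : Board) : Prop :=
  ∀ s, B s = none ∨ B s = some redPawn ∨ ∃ t, s = N.p t 0 ∧ B s = some blackPawn

/-- If there is a black pawn at the beginning of the track `t`, it is guarded. -/
def Dormant (N : Network) (B : Board) (t : N.T) : Prop :=
  B (N.p t 0) = some blackPawn → ∀ g, IsGuard (N.p t 0) g → B g ≠ none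

/-- A board on which no black piece can move or be captured. -/
def Dead (N : Network) (B : Board) : Prop := N.Typed B ∧ ∀ t, N.Dormant B t

/-- A board on which the pawn of the track `t` is ready to go. -/
structure Ready (N : Network) (t : N.T) (B : Board) : Prop where
  typed : N.Typed B
  dormant : ∀ t', t' ≠ t → N.Dormant B t'
  zone : ∀ s ∈ N.Z t, s ≠ N.p t 1 → B s = N.B s
  gate : B (N.p t 1) = none

lemma Typed.black {B : Board} (h : N.Typed B) {s : Square} {q : Piece} (hq : B s = some q)
    (hb : q.owner = .black) : q = blackPawn ∧ ∃ t, s = N.p t 0 := by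
  rcases h s with h | h | ⟨t, h1, h⟩ <;> rw [h] at hq
  · cases hq
  · cases hq; cases hb
  · cases hq; exact ⟨rfl, t, h1⟩

lemma Typed.red {B : Board} (h : N.Typed B) {s : Square} {q : Piece} (hq : B s = some q)
    (hb : q.owner = .red) : q = redPawn := by
  rcases h s with h | h | ⟨t, h1, h⟩ <;> rw [h] at hq <;> cases hq
  · rfl
  · cases hb

lemma Dormant.not_jumpStep {B : Board} {t : N.T} (h : N.Dormant B t)
    (hb : B (N.p t 0) = some blackPawn) (b : Board × Square) : ¬ JumpStep (B, N.p t 0) b := by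
  rintro ⟨p, q, e, h1, h2, -, -, h5, -⟩
  obtain rfl : blackPawn = p := Option.some_injective _ (hb.symm.trans h1)
  exact h hb _ ⟨e, isUp_of_canGo_black h2, .inr (.inl rfl)⟩ h5

lemma Dormant.not_simpleStep {B : Board} {t : N.T} (h : N.Dormant B t)
    (hb : B (N.p t 0) = some blackPawn) (B' : Board) : ¬ SimpleStep B (N.p t 0) B' := by
  rintro ⟨p, e, h1, h2, h3, -⟩
  obtain rfl : blackPawn = p := Option.some_injective _ (hb.symm.trans h1)
  exact h hb _ ⟨e, isUp_of_canGo_black h2, .inl rfl⟩ h3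

lemma exists_jumpStep_of_finiteJump {B B' : Board} {s : Square} (h : FiniteJump B s B') :
    ∃ b, JumpStep (B, s) b := by
  obtain ⟨t, h⟩ := h
  obtain ⟨b, hb, -⟩ := Relation.TransGen.head'_iff.1 h
  exact ⟨b, hb⟩

lemma exists_jumpStep_of_infiniteJump {B B' : Board} {s : Square} (h : InfiniteJump B s B') :
    ∃ b, JumpStep (B, s) b := by
  obtain ⟨f, h0, hf, -⟩ := h
  exact ⟨f 1, h0 ▸ hf 0⟩

lemma Dead.wonBy {B : Board} (h : N.Dead B) : Position.WonBy ⟨B, .black⟩ .red := by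
  refine ⟨rfl, ?_⟩
  rintro Y ⟨-, s, ⟨p, hp, ho⟩, hm⟩
  obtain ⟨rfl, t, rfl⟩ := h.1.black hp ho
  have hj : ¬ ∃ b, JumpStep (B, N.p t 0) b := fun ⟨b, hb⟩ => (h.2 t).not_jumpStep hp b hb
  rcases hm with ⟨-, hm | hm⟩ | ⟨-, hm⟩
  · exact hj (exists_jumpStep_of_finiteJump hm)
  · exact hj (exists_jumpStep_of_infiniteJump hm)
  · exact (h.2 t).not_simpleStep hp _ hm

/-- Needed after an infinite jump: Red's quiet move is legal only if no capture is available. -/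
lemma Dead.not_canJump_red {B : Board} (h : N.Dead B) : ¬ Position.CanJump ⟨B, .red⟩ := by
  rintro ⟨s, ⟨p, hp, ho⟩, b, p', q, e, h1, h2, h3, h4, h5, -⟩
  obtain rfl : p = p' := Option.some_injective _ (hp.symm.trans h1)
  obtain rfl := h.1.red hp ho
  have hq : q.owner = .black := by
    rcases hq : q.owner with _ | _
    · exact absurd hq h4
    · rfl
  obtain ⟨rfl, t, ht⟩ := h.1.black h3 hq
  simp only at ht h3 h5
  rw [ht] at h3 h5
  exact h.2 t h3 _ ⟨-e, isUp_of_canGo_red h2, .inr (.inr (sub_neg_eq_add _ _).symm)⟩ h5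

/-! ### Play along a single track -/

open Classical in
/-- The board after the pawn of the track `t` has made `k` jumps. -/
noncomputable def trav (N : Network) (B : Board) (t : N.T) (k : ℕ) : Board := fun s =>
  if s = N.p t k then some blackPawn
  else if s = N.p t 0 ∨ ∃ i < k, s = N.p t i + N.d t i then none else B s

open Classical in
/-- The board after the pawn of the track `t` has been captured after `k + 1` jumps. -/
noncomputable def cap (N : Network) (B : Board) (t : N.T) (k : ℕ) : Board := fun s =>
  if s = N.p t k + N.d t k then some redPawn
  else if s = N.p t 0 ∨ s = N.p t (k + 1) ∨ s = N.p t (k + 1) + N.d t k ∨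
    ∃ i < k, s = N.p t i + N.d t i then none else B s

lemma trav_self (B : Board) (t : N.T) (k : ℕ) : N.trav B t k (N.p t k) = some blackPawn :=
  if_pos rfl

lemma trav_ahead (B : Board) (t : N.T) (k : ℕ) {s : Square} (hs : (N.p t k).2 < s.2) :
    N.trav B t k s = B s := by
  rw [p_snd] at hs
  rw [trav, if_neg (ne_of_snd (by rw [p_snd]; omega)), if_neg]
  rintro (rfl | ⟨i, hi, rfl⟩)
  · omega
  · rw [mid_snd] at hs; omega

lemma Ready.black {t : N.T} {B : Board} (h : N.Ready t B) :
    B (N.p t 0) = some blackPawn := by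
  rw [h.zone _ (N.start t).1 (ne_of_snd (by rw [p_snd t 1]; push_cast; omega)), (N.start t).2]

lemma Ready.trav_zero {t : N.T} {B : Board} (h : N.Ready t B) : N.trav B t 0 = B := by
  funext s
  rw [trav]
  split_ifs with h1 h2
  · rw [h1, h.black]
  · simp_all
  · rfl

lemma Ready.land {t : N.T} {B : Board} (h : N.Ready t B) {k : ℕ} (hk : N.ok t k) :
    B (N.p t (k + 1)) = none := by
  rcases k with _ | k
  · exact h.gate
  · rw [h.zone _ (N.land t k hk).1 (ne_of_snd (by rw [p_snd t 1, p_snd]; push_cast; omega)),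
      (N.land t k hk).2]

lemma Ready.mid {t : N.T} {B : Board} (h : N.Ready t B) {k : ℕ} (hk : N.ok t k) :
    B (N.p t k + N.d t k) = some redPawn := by
  rw [h.zone _ (N.mid t k hk).1 (ne_of_snd (by rw [p_snd t 1, mid_snd]; push_cast; omega)),
      (N.mid t k hk).2]

lemma Ready.head {t : N.T} {B : Board} (h : N.Ready t B) {k : ℕ} (hk : N.ok t k) :
    B (N.p t (k + 1) + N.d t k) = some redPawn := by
  rw [h.zone _ (N.head t k hk).1 (ne_of_snd (by rw [p_snd t 1, head_snd]; push_cast; omega)),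
      (N.head t k hk).2]

/-- The pawn has no choice of direction: `side` blocks every jump except the one along the track.
Hence stopping times are the only freedom. -/
lemma Ready.jumpStep_iff {t : N.T} {B : Board} (h : N.Ready t B) {k : ℕ}
    (hk : ∀ i < k, N.ok t i) (b : Board × Square) :
    JumpStep (N.trav B t k, N.p t k) b ↔ N.ok t k ∧ b = (N.trav B t (k + 1), N.p t (k + 1)) := by
  have hboard : Function.update (Function.update (Function.update (N.trav B t k) (N.p t k) none)
      (N.p t k + N.d t k) none) (N.p t k + N.d t k + N.d t k) (some blackPawn) =
      N.trav B t (k + 1) := by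
    rw [← N.p_succ]
    funext s
    by_cases h1 : s = N.p t (k + 1)
    · rw [h1, Function.update_self, trav_self]
    rw [Function.update_of_ne h1]
    by_cases h2 : s = N.p t k + N.d t k
    · rw [h2, Function.update_self, trav, if_neg (h2 ▸ h1), if_pos (.inr ⟨k, by omega, rfl⟩)]
    rw [Function.update_of_ne h2]
    by_cases h3 : s = N.p t k
    · rw [h3, Function.update_self, trav, if_neg (h3 ▸ h1)]
      rcases k with _ | k
      · simp
      · split_ifs
        · rfl
        · exact (h.land (hk k (by omega))).symm
    rw [Function.update_of_ne h3, trav, trav, if_neg h1, if_neg h3]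
    congr 1
    simp only [eq_iff_iff, Nat.lt_succ_iff]
    refine or_congr_right ⟨fun ⟨i, hi, e⟩ => ⟨i, hi.le, e⟩, fun ⟨i, hi, e⟩ => ⟨i, ?_, e⟩⟩
    rcases hi.eq_or_lt with rfl | hlt
    · exact absurd e h2
    · exact hlt
  constructor
  · rintro ⟨p, q, e, h1, h2, -, -, h5, h6, h7⟩
    simp only [trav_self, Option.some.injEq] at h1
    subst h1
    have he := isUp_of_canGo_black h2
    have hB : B (N.p t k + e + e) = none := by
      rw [← h5]
      refine (trav_ahead B t k ?_).symm
      rw [Prod.snd_add, Prod.snd_add, he.snd]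
      omega
    have hek : e = N.d t k ∧ N.ok t k := by
      by_contra hne
      have hne' : e ≠ N.d t k ∨ ¬ N.ok t k := by tauto
      obtain ⟨s1, s2⟩ := N.side t k e hk he hne'
      rw [← h.zone _ s1] at s2
      · exact s2 hB
      -- The zone says nothing about the gate. By its height only the first jump can land there, and
      -- then its direction is that of the track.
      · intro heq
        have hs := congrArg Prod.snd heq
        rw [p_snd t 1, Prod.snd_add, Prod.snd_add, he.snd, p_snd] at hs
        obtain rfl : k = 0 := by push_cast at hs; omega
        rw [N.p_succ, add_assoc, add_assoc] at heq
        have := eq_of_add_self_eq (add_left_cancel heq)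
        exact hne ⟨this, N.ok_zero t⟩
    obtain ⟨rfl, hok⟩ := hek
    exact ⟨hok, Prod.ext (h7.trans hboard) (h6.trans (N.p_succ t k).symm)⟩
  · rintro ⟨hok, rfl⟩
    refine ⟨blackPawn, redPawn, N.d t k, trav_self B t k, (N.up t k).canGo_black, ?_,
      by simp, ?_, N.p_succ t k, hboard.symm⟩
    · simp only
      rw [trav_ahead, h.mid hok]
      rw [mid_snd, p_snd]; omega
    · simp only
      rw [← N.p_succ, trav_ahead, h.land hok]
      rw [p_snd, p_snd t (k + 1)]; push_cast; omega

lemma Ready.eq_of_transGen {t : N.T} {B : Board} (h : N.Ready t B) {b : Board × Square}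
    (hb : Relation.TransGen JumpStep (B, N.p t 0) b) :
    ∃ k, N.ok t k ∧ b = (N.trav B t (k + 1), N.p t (k + 1)) := by
  induction hb with
  | single hb =>
    rw [← h.trav_zero] at hb
    exact ⟨0, (h.jumpStep_iff (by simp) _).1 hb⟩
  | tail _ hb ih =>
    obtain ⟨k, hk, rfl⟩ := ih
    exact ⟨k + 1, (h.jumpStep_iff (fun i hi => ok_le hk (by omega)) _).1 hb⟩

lemma Ready.transGen {t : N.T} {B : Board} (h : N.Ready t B) {k : ℕ} (hk : N.ok t k) :
    Relation.TransGen JumpStep (B, N.p t 0) (N.trav B t (k + 1), N.p t (k + 1)) := by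
  induction k with
  | zero =>
    have := (h.jumpStep_iff (k := 0) (by simp) _).2 ⟨hk, rfl⟩
    rw [h.trav_zero] at this
    exact .single this
  | succ k ih =>
    exact .tail (ih (N.ok_of_succ t k hk))
      ((h.jumpStep_iff (fun i hi => ok_le hk (by omega)) _).2 ⟨hk, rfl⟩)

open Classical in
-- All other black pawns are dormant, so the jumper is the pawn of `t`, and it stops after some jump
-- or never. In the latter case the only pieces lost are the jumper and those it jumped.
lemma Ready.black_move {t : N.T} {B : Board} (h : N.Ready t B) {Y : Position}
    (hY : Position.LegalMove ⟨B, .black⟩ Y) :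
    Y.turn = .red ∧ ((∃ k, N.ok t k ∧ Y.board = N.trav B t (k + 1)) ∨
      ((∀ k, N.ok t k) ∧ ∀ s, Y.board s =
        if s = N.p t 0 ∨ ∃ i, s = N.p t i + N.d t i then none else B s)) := by
  obtain ⟨hturn, s, ⟨p, hp, ho⟩, hm⟩ := hY
  refine ⟨hturn, ?_⟩
  obtain ⟨rfl, t', rfl⟩ := h.typed.black hp ho
  have hcan : Position.CanJump ⟨B, .black⟩ := by
    obtain ⟨b, hb, -⟩ := Relation.TransGen.head'_iff.1 (h.transGen (N.ok_zero t))
    exact ⟨N.p t 0, ⟨_, h.black, rfl⟩, b, hb⟩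
  have hj : (∃ b, JumpStep (B, N.p t' 0) b) → t' = t := by
    rintro ⟨b, hb⟩
    by_contra hne
    exact (h.dormant t' hne).not_jumpStep hp b hb
  rcases hm with ⟨-, hm | hm⟩ | ⟨hm, -⟩
  · obtain rfl := hj (exists_jumpStep_of_finiteJump hm)
    obtain ⟨s, hs⟩ := hm
    obtain ⟨k, hk, e⟩ := h.eq_of_transGen hs
    exact .inl ⟨k, hk, congrArg Prod.fst e⟩
  · obtain rfl := hj (exists_jumpStep_of_infiniteJump hm)
    obtain ⟨f, h0, hf, hB⟩ := hm
    have key : ∀ n, (∀ i < n, N.ok t' i) ∧ f n = (N.trav B t' n, N.p t' n) := by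
      intro n
      induction n with
      | zero => exact ⟨by simp, by rw [h0, h.trav_zero]⟩
      | succ n ih =>
        have := hf n
        rw [ih.2] at this
        obtain ⟨h1, h2⟩ := (h.jumpStep_iff ih.1 _).1 this
        exact ⟨fun i hi => ok_le h1 (by omega), h2⟩
    refine .inr ⟨fun k => (key (k + 1)).1 k (by omega), fun s => ?_⟩
    split_ifs with hs
    · apply (hB s).1
      rcases hs with rfl | ⟨i, rfl⟩
      · refine ⟨1, ?_⟩
        rw [(key 1).2]
        change N.trav B t' 1 (N.p t' 0) = none
        rw [trav, if_neg (ne_of_snd (by rw [p_snd t' 1]; push_cast; omega)), if_pos (.inl rfl)]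
      · refine ⟨i + 1, ?_⟩
        rw [(key (i + 1)).2]
        change N.trav B t' (i + 1) (N.p t' i + N.d t' i) = none
        rw [trav, if_neg (ne_of_snd (by rw [p_snd t' (i + 1), mid_snd]; push_cast; omega)),
          if_pos (.inr ⟨i, by omega, rfl⟩)]
    · by_cases hn : B s = none
      · rw [hn]
        exact (hB s).1 ⟨0, by rw [h0]; exact hn⟩
      · apply (hB s).2
        intro n
        rw [(key n).2]
        simp only [trav]
        split_ifs with h1 h2
        · simp
        · exact absurd (h2.imp_right fun ⟨i, _, e⟩ => ⟨i, e⟩) hs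
        · exact hn
  · exact absurd hcan hm

lemma Ready.legalMove_black {t : N.T} {B : Board} (h : N.Ready t B) {k : ℕ} (hk : N.ok t k) :
    Position.LegalMove ⟨B, .black⟩ ⟨N.trav B t (k + 1), .red⟩ := by
  refine ⟨rfl, N.p t 0, ⟨_, h.black, rfl⟩, .inl ⟨?_, .inl ⟨_, h.transGen hk⟩⟩⟩
  obtain ⟨b, hb, -⟩ := Relation.TransGen.head'_iff.1 (h.transGen hk)
  exact ⟨N.p t 0, ⟨_, h.black, rfl⟩, b, hb⟩

lemma update_trav_eq_cap (B : Board) (t : N.T) (k : ℕ) :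
    Function.update (Function.update (Function.update (N.trav B t (k + 1))
      (N.p t (k + 1) + N.d t k) none) (N.p t (k + 1)) none) (N.p t k + N.d t k) (some redPawn) =
    N.cap B t k := by
  funext s
  rw [cap]
  by_cases h1 : s = N.p t k + N.d t k
  · rw [h1, Function.update_self, if_pos rfl]
  rw [Function.update_of_ne h1, if_neg h1]
  by_cases h2 : s = N.p t (k + 1)
  · rw [h2, Function.update_self, if_pos (by simp)]
  rw [Function.update_of_ne h2]
  by_cases h3 : s = N.p t (k + 1) + N.d t k
  · rw [h3, Function.update_self, if_pos (by simp)]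
  rw [Function.update_of_ne h3, trav, if_neg h2]
  congr 1
  simp only [eq_iff_iff, h2, h3, false_or, Nat.lt_succ_iff]
  refine or_congr_right ⟨fun ⟨i, hi, e⟩ => ⟨i, ?_, e⟩, fun ⟨i, hi, e⟩ => ⟨i, hi.le, e⟩⟩
  rcases hi.eq_or_lt with rfl | hlt
  · exact absurd e h1
  · exact hlt

lemma add_neg_landing (t : N.T) (k : ℕ) :
    N.p t (k + 1) + N.d t k + -N.d t k + -N.d t k = N.p t k + N.d t k := by
  rw [N.p_succ]
  abel

lemma Ready.jumpStep_cap {t : N.T} {B : Board} (h : N.Ready t B) {k : ℕ} (hk : N.ok t k) :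
    JumpStep (N.trav B t (k + 1), N.p t (k + 1) + N.d t k)
      (N.cap B t k, N.p t k + N.d t k) := by
  refine ⟨redPawn, blackPawn, -N.d t k, ?_, (N.up t k).canGo_red, ?_, by simp, ?_, ?_, ?_⟩
  · simp only
    rw [trav_ahead, h.head hk]
    rw [head_snd, p_snd]; push_cast; omega
  · simp only [add_neg_cancel_right]
    exact trav_self B t (k + 1)
  · simp only
    rw [add_neg_landing, trav,
      if_neg (ne_of_snd (by rw [mid_snd, p_snd t (k + 1)]; push_cast; omega)),
      if_pos (.inr ⟨k, by omega, rfl⟩)]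
  · exact (add_neg_landing t k).symm
  · simp only
    rw [add_neg_landing, add_neg_cancel_right, update_trav_eq_cap]

lemma Ready.canJump_red {t : N.T} {B : Board} (h : N.Ready t B) {k : ℕ} (hk : N.ok t k) :
    Position.CanJump ⟨N.trav B t (k + 1), .red⟩ := by
  have hj := h.jumpStep_cap hk
  refine ⟨N.p t (k + 1) + N.d t k, ⟨redPawn, ?_, rfl⟩, _, hj⟩
  simp only
  rw [trav_ahead, h.head hk]
  rw [head_snd, p_snd]; push_cast; omega

lemma Ready.legalMove_red {t : N.T} {B : Board} (h : N.Ready t B) {k : ℕ} (hk : N.ok t k) :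
    Position.LegalMove ⟨N.trav B t (k + 1), .red⟩ ⟨N.cap B t k, .black⟩ := by
  refine ⟨rfl, N.p t (k + 1) + N.d t k, ⟨redPawn, ?_, rfl⟩,
    .inl ⟨h.canJump_red hk, .inl ⟨_, .single (h.jumpStep_cap hk)⟩⟩⟩
  simp only
  rw [trav_ahead, h.head hk]
  rw [head_snd, p_snd]; push_cast; omega

lemma Ready.cap_typed {t : N.T} {B : Board} (h : N.Ready t B) (k : ℕ) :
    N.Typed (N.cap B t k) := by
  intro s
  rw [cap]
  split_ifs
  · simp
  · simp
  · exact h.typed s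

lemma cap_eq_black {t t' : N.T} {B : Board} {k : ℕ}
    (hc : N.cap B t k (N.p t' 0) = some blackPawn) : t' ≠ t ∧ B (N.p t' 0) = some blackPawn := by
  rw [cap] at hc
  split_ifs at hc with h1 h2
  · simp at hc
  · exact ⟨fun e => h2 (.inl (e ▸ rfl)), hc⟩

lemma not_isGuard_p {t t' : N.T} (ht : t' ≠ t) {k : ℕ} (hk : N.ok t k) :
    ¬ IsGuard (N.p t' 0) (N.p t (k + 1)) := by
  rcases k with _ | k
  · exact N.sep_gate t t' ht.symm
  · exact fun hg => N.guard t' _ hg (N.land t k hk).2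

/-- The separation conditions exclude every emptied square except that of the capturing pawn, so a
pawn can only be woken through its gate. -/
lemma Ready.cap_guard {t t' : N.T} {B : Board} (h : N.Ready t B) {k : ℕ} (hk : N.ok t k)
    (ht : t' ≠ t) (hb : B (N.p t' 0) = some blackPawn) {g : Square} (hg : IsGuard (N.p t' 0) g)
    (hn : N.cap B t k g = none) : N.Next t k t' := by
  rw [cap] at hn
  split_ifs at hn with h1 h2
  · rcases h2 with rfl | rfl | rfl | ⟨i, hi, rfl⟩
    · exact absurd hg (N.sep_start t t' ht.symm)
    · exact absurd hg (not_isGuard_p ht hk)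
    · exact N.sep_head t t' k ht.symm hk hg
    · exact absurd hg (N.sep_mid t t' i ht.symm (ok_le hk hi.le))
  · exact absurd hn (h.dormant t' ht hb g hg)

lemma Ready.cap_dead {t : N.T} {B : Board} (h : N.Ready t B) {k : ℕ} (hk : N.ok t k)
    (hn : ∀ t', ¬ N.Next t k t') : N.Dead (N.cap B t k) :=
  ⟨h.cap_typed k, fun t' hb _ hg he =>
    hn t' (h.cap_guard hk (cap_eq_black hb).1 (cap_eq_black hb).2 hg he)⟩

/-- A common gate would be a guard of both waiting pawns, contrary to `sep_gate`. -/
lemma next_unique_track {t t' t'' : N.T} {k : ℕ} (h : N.Next t k t') (h' : N.Next t k t'') :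
    t'' = t' := by
  by_contra hne
  refine N.sep_gate t' t'' (Ne.symm hne) ?_
  rw [N.next_gate _ _ _ h, ← N.next_gate _ _ _ h', N.p_succ]
  exact ⟨_, N.up t'' 0, .inr (.inl rfl)⟩

lemma Ready.cap_ready {t t' : N.T} {B : Board} (h : N.Ready t B) {k : ℕ} (hn : N.Next t k t') :
    N.Ready t' (N.cap B t k) where
  typed := h.cap_typed k
  dormant t'' ht hb _ hg he :=
    ht (next_unique_track hn (h.cap_guard (N.next_ok _ _ _ hn) (cap_eq_black hb).1
      (cap_eq_black hb).2 hg he))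
  zone s hs hg := by
    obtain ⟨h1, h2, h3, h4, h5⟩ := N.next_zone t k t' hn s hs hg
    rw [cap, if_neg (h5 k le_rfl), if_neg, h.zone s h1 h3]
    rintro (e | e | e | ⟨i, hi, e⟩)
    · exact h2 e
    · exact h4 e
    · exact hg (e.trans (N.next_gate _ _ _ hn).symm)
    · exact h5 i hi.le e
  gate := by
    rw [N.next_gate _ _ _ hn, cap, if_neg (ne_of_snd (by rw [head_snd, mid_snd]; omega)),
      if_pos (by simp)]

/-- An infinite jump wakes no other pawn. Red answers with the pawn from `spare`, which is no gate,
so Black remains stuck. -/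
lemma Ready.valued_of_forever {t : N.T} {B : Board} (h : N.Ready t B) (hok : ∀ k, N.ok t k)
    {B' : Board} (hB' : ∀ s, (s = N.p t 0 ∨ ∃ i, s = N.p t i + N.d t i) → B' s = none)
    (hB : ∀ s, ¬ (s = N.p t 0 ∨ ∃ i, s = N.p t i + N.d t i) → B' s = B s) :
    Position.Valued ⟨B', .red⟩ := by
  have hblack : ∀ t', B' (N.p t' 0) = some blackPawn →
      t' ≠ t ∧ B (N.p t' 0) = some blackPawn := by
    intro t' hb
    have hs : ¬ (N.p t' 0 = N.p t 0 ∨ ∃ i, N.p t' 0 = N.p t i + N.d t i) := by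
      intro hs
      rw [hB' _ hs] at hb
      cases hb
    exact ⟨fun e => hs (.inl (e ▸ rfl)), (hB _ hs).symm.trans hb⟩
  have hdead : N.Dead B' := by
    refine ⟨fun s => ?_, fun t' hb g hg hn => ?_⟩
    · by_cases hs : s = N.p t 0 ∨ ∃ i, s = N.p t i + N.d t i
      · exact .inl (hB' s hs)
      · rw [hB s hs]
        exact h.typed s
    · obtain ⟨ht, hb⟩ := hblack t' hb
      by_cases hs : g = N.p t 0 ∨ ∃ i, g = N.p t i + N.d t i
      · rcases hs with rfl | ⟨i, rfl⟩
        · exact N.sep_start t t' ht.symm hg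
        · exact N.sep_mid t t' i ht.symm (hok i) hg
      · rw [hB g hs] at hn
        exact h.dormant t' ht hb g hg hn
  obtain ⟨k, hk, hkm⟩ := N.spare t hok
  have hhead : B' (N.p t (k + 1) + N.d t k) = some redPawn := by
    rw [hB, h.head (hok k)]
    rintro (e | ⟨i, e⟩)
    · exact ne_of_snd (by rw [head_snd]; omega) e
    · exact hkm i e
  have hland : B' (N.p t (k + 1)) = none := by
    rw [hB, h.land (hok k)]
    rintro (e | ⟨i, e⟩)
    · exact ne_of_snd (by rw [p_snd]; push_cast; omega) e
    · exact ne_of_snd (by rw [mid_snd, p_snd]; push_cast; omega) e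
  set B'' : Board := Function.update (Function.update B' (N.p t (k + 1) + N.d t k) none)
    (N.p t (k + 1)) (some redPawn) with hB''
  have hmove : Position.LegalMove ⟨B', .red⟩ ⟨B'', .black⟩ := by
    refine ⟨rfl, _, ⟨_, hhead, rfl⟩, .inr ⟨hdead.not_canJump_red, redPawn, -N.d t k, hhead,
      (N.up t k).canGo_red, ?_, ?_⟩⟩
    · rw [add_neg_cancel_right]
      exact hland
    · rw [add_neg_cancel_right]
  have hdead' : N.Dead B'' := by
    refine ⟨fun s => ?_, fun t' hb g hg hn => ?_⟩
    · by_cases h1 : s = N.p t (k + 1)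
      · rw [h1, hB'', Function.update_self]; simp
      rw [hB'', Function.update_of_ne h1]
      by_cases h2 : s = N.p t (k + 1) + N.d t k
      · rw [h2, Function.update_self]; simp
      rw [Function.update_of_ne h2]
      exact hdead.1 s
    · have hb' : B' (N.p t' 0) = some blackPawn := by
        rw [hB''] at hb
        by_cases h1 : N.p t' 0 = N.p t (k + 1)
        · rw [h1, Function.update_self] at hb
          simp at hb
        rw [Function.update_of_ne h1] at hb
        by_cases h2 : N.p t' 0 = N.p t (k + 1) + N.d t k
        · rw [h2, Function.update_self] at hb
          simp at hb
        rwa [Function.update_of_ne h2] at hb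
      rw [hB''] at hn
      by_cases h1 : g = N.p t (k + 1)
      · rw [h1, Function.update_self] at hn
        simp at hn
      rw [Function.update_of_ne h1] at hn
      by_cases h2 : g = N.p t (k + 1) + N.d t k
      · subst h2
        exact hk t' (N.sep_head t t' k (hblack t' hb').1.symm (hok k) hg)
      rw [Function.update_of_ne h2] at hn
      exact hdead.2 t' hb' g hg hn
  exact Position.valued_of_red rfl hmove (Position.valued_of_won hdead'.wonBy)

/-! ### Existence of values and lower bounds -/

/-- Red's strategy is to capture with the pawn just ahead of the stopping square: Black is then
stuck or on a later track, and `wf` allows induction. -/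
theorem Ready.valued (t : N.T) : ∀ B, N.Ready t B → Position.Valued ⟨B, .black⟩ := by
  classical
  induction t using N.wf.induction with
  | _ t ih =>
  intro B h
  refine Position.valued_of_black rfl fun Y hY => ?_
  obtain ⟨BY, tY⟩ := Y
  obtain ⟨hturn, ⟨k, hk, hb⟩ | ⟨hok, hb⟩⟩ := h.black_move hY
  · simp only at hturn hb
    subst hturn hb
    refine Position.valued_of_red rfl (h.legalMove_red hk) ?_
    by_cases hn : ∃ t', N.Next t k t'
    · obtain ⟨t', hn⟩ := hn
      exact ih t' ⟨k, hn⟩ _ (h.cap_ready hn)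
    · exact Position.valued_of_won (h.cap_dead hk (not_exists.1 hn)).wonBy
  · simp only at hturn
    subst hturn
    refine h.valued_of_forever hok (fun s hs => ?_) (fun s hs => ?_)
    · exact (hb s).trans (if_pos hs)
    · exact (hb s).trans (if_neg hs)

/-- A waiting black pawn of which at most the gate is vacant cannot be jumped from above. -/
lemma below_ne_none {B : Board} {t : N.T}
    (h : ∀ g, IsGuard (N.p t 0) g → B g = none → g = N.p t 1) {e : Square} (he : IsUp e) :
    B (N.p t 0 - e) ≠ none := by
  intro hn
  have := congrArg Prod.snd (h _ ⟨e, he, .inr (.inr rfl)⟩ hn)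
  rw [p_snd t 1, Prod.snd_sub, he.snd] at this
  push_cast at this
  omega

lemma Ready.red_jumpStep {t t' : N.T} {B : Board} (h : N.Ready t B) {k : ℕ}
    (hn : N.Next t k t') {s : Square} {p : Piece} (hp : N.trav B t (k + 1) s = some p)
    (ho : p.owner = .red) {b : Board × Square} (hj : JumpStep (N.trav B t (k + 1), s) b) :
    b = (N.cap B t k, N.p t k + N.d t k) := by
  have hk := N.next_ok _ _ _ hn
  obtain ⟨p', q, e, h1, h2, h3, h4, h5, h6, h7⟩ := hj
  obtain rfl : p = p' := Option.some_injective _ (hp.symm.trans h1)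
  simp only at h3 h5 h6 h7
  have hpr : p = redPawn := by
    rw [trav] at hp
    split_ifs at hp
    · cases hp; cases ho
    · exact h.typed.red hp ho
  subst hpr
  have hqb : q.owner = .black := by
    rcases hq : q.owner with _ | _
    · exact absurd hq h4
    · rfl
  have he := isUp_of_canGo_red h2
  have hse : s = s + e - e := (add_sub_cancel_right s e).symm
  by_cases hs : s + e = N.p t (k + 1)
  · rw [hs] at h5 h6 h7
    by_cases hed : -e = N.d t k
    · obtain rfl : e = -N.d t k := by rw [← hed, neg_neg]
      obtain rfl : s = N.p t (k + 1) + N.d t k := by rw [hse, hs, sub_neg_eq_add]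
      have hl := add_neg_landing t k
      rw [add_neg_cancel_right] at hl
      rw [hl, update_trav_eq_cap] at h7
      exact Prod.ext h7 (h6.trans hl)
    · exfalso
      obtain ⟨u1, u2⟩ := N.next_unique t k t' (-e) hn he hed
      rw [sub_neg_eq_add] at u1 u2
      have he2 : e.2 = -1 := by have := he.snd; rw [Prod.snd_neg] at this; omega
      have hsnd : (N.p t (k + 1) + e).2 = (N.p t 0).2 + 2 * k + 1 := by
        rw [Prod.snd_add, p_snd, he2]; push_cast; ring
      rw [trav, if_neg (ne_of_snd (by rw [hsnd, p_snd t (k + 1)]; push_cast; omega)), if_neg,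
        h.zone _ u1 (ne_of_snd (by rw [hsnd, p_snd t 1]; push_cast; omega))] at h5
      · exact u2 h5
      · rintro (e' | ⟨i, hi, e'⟩)
        · exact ne_of_snd (by rw [hsnd]; omega) e'
        · have hh := congrArg Prod.snd e'
          rw [hsnd, mid_snd] at hh
          obtain rfl : i = k := by omega
          rw [N.p_succ, add_assoc, add_eq_left] at e'
          exact hed (neg_eq_of_add_eq_zero_left e')
  -- The victim would be some other waiting pawn, but those are still fully guarded.
  · exfalso
    rw [trav, if_neg hs] at h3
    split_ifs at h3 with h8
    obtain ⟨rfl, t'', ht''⟩ := h.typed.black h3 hqb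
    have hne : t'' ≠ t := fun e' => h8 (.inl (e' ▸ ht''))
    rw [ht''] at h3 h5
    refine below_ne_none (B := N.trav B t (k + 1)) (e := -e) (t := t'') ?_ he ?_
    · intro g hg hgn
      exfalso
      rw [trav] at hgn
      split_ifs at hgn with h9 h10
      · rcases h10 with rfl | ⟨i, hi, rfl⟩
        · exact N.sep_start t t'' hne.symm hg
        · exact N.sep_mid t t'' i hne.symm (ok_le hk (by omega)) hg
      · exact h.dormant t'' hne h3 g hg hgn
    · rw [sub_neg_eq_add, h5]

/-- The capture uncovers only a gate, which lies above its waiting pawn, whereas a red jump needs an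
empty square below. So Red cannot prolong the capture. -/
lemma Ready.not_jumpStep_cap {t t' : N.T} {B : Board} (h : N.Ready t B) {k : ℕ}
    (hn : N.Next t k t') (b : Board × Square) :
    ¬ JumpStep (N.cap B t k, N.p t k + N.d t k) b := by
  have hk := N.next_ok _ _ _ hn
  rintro ⟨p, q, e, h1, h2, h3, h4, h5, -⟩
  simp only at h1 h3 h5
  have h1' : N.cap B t k (N.p t k + N.d t k) = some redPawn := if_pos rfl
  obtain rfl : redPawn = p := Option.some_injective _ (h1'.symm.trans h1)
  have hqb : q.owner = .black := by
    rcases hq : q.owner with _ | _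
    · exact absurd hq h4
    · rfl
  have he := isUp_of_canGo_red h2
  obtain ⟨rfl, t'', ht''⟩ := (h.cap_typed k).black h3 hqb
  rw [ht''] at h3 h5
  refine below_ne_none (B := N.cap B t k) (t := t'') (e := -e) (fun g hg hgn => ?_) he
    (by rw [sub_neg_eq_add, h5])
  obtain ⟨hne, hb⟩ := cap_eq_black h3
  have hn' := h.cap_guard hk hne hb hg hgn
  rw [N.next_gate _ _ _ hn']
  rw [cap] at hgn
  split_ifs at hgn with h9 h10
  · rcases h10 with rfl | rfl | rfl | ⟨i, hi, rfl⟩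
    · exact absurd hg (N.sep_start t t'' hne.symm)
    · exact absurd hg (not_isGuard_p hne hk)
    · rfl
    · exact absurd hg (N.sep_mid t t'' i hne.symm (ok_le hk hi.le))
  · exact absurd hgn (h.dormant t'' hne hb g hg)

lemma Ready.red_move {t t' : N.T} {B : Board} (h : N.Ready t B) {k : ℕ} (hn : N.Next t k t')
    {Y : Position} (hY : Position.LegalMove ⟨N.trav B t (k + 1), .red⟩ Y) :
    Y = ⟨N.cap B t k, .black⟩ := by
  obtain ⟨BY, tY⟩ := Y
  obtain ⟨hturn, s, ⟨p, hp, ho⟩, hm⟩ := hY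
  simp only at hturn hp ho hm
  subst hturn
  rcases hm with ⟨-, ⟨u, hm⟩ | ⟨f, h0, hf, -⟩⟩ | ⟨hm, -⟩
  · obtain ⟨b, hb, hr⟩ := Relation.TransGen.head'_iff.1 hm
    have := h.red_jumpStep hn hp ho hb
    subst this
    rcases Relation.ReflTransGen.cases_head hr with e | ⟨c, hc, -⟩
    · cases e
      rfl
    · exact absurd hc (h.not_jumpStep_cap hn c)
  · have h1 := hf 0
    rw [h0] at h1
    have h2 := hf 1
    rw [zero_add] at h1
    rw [h.red_jumpStep hn hp ho h1] at h2
    exact absurd h2 (h.not_jumpStep_cap hn _)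
  · exact absurd (h.canJump_red (N.next_ok _ _ _ hn)) hm

/-- For each `δ < lb t` Black stops where the next track has bound at least `δ`. Red's reply is
forced by `Ready.red_move` and contributes the missing one. -/
theorem Ready.atLeast (lb : N.T → Ordinal.{0})
    (hlb : ∀ t, ∀ δ < lb t, ∃ k t', N.Next t k t' ∧ δ ≤ lb t') (t : N.T) :
    ∀ B, N.Ready t B → Position.AtLeast (lb t) ⟨B, .black⟩ := by
  induction t using N.wf.induction with
  | _ t ih =>
  intro B h
  refine Position.atLeast_of_black rfl fun δ hδ => ?_
  obtain ⟨k, t', hn, hle⟩ := hlb t δ hδ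
  refine ⟨_, h.legalMove_black (N.next_ok _ _ _ hn), ?_⟩
  refine Position.atLeast_of_red rfl fun Y hY γ hγ => ?_
  obtain rfl := h.red_move hn hY
  exact hle.trans (ih t' ⟨k, hn⟩ _ (h.cap_ready hn) γ hγ)

open Classical in
/-- The position of the network in which the gate of the track `t` is open. -/
noncomputable def opening (N : Network) (t : N.T) : Board := Function.update N.B (N.p t 1) none

lemma ready_opening (t : N.T) : N.Ready t (N.opening t) where
  typed s := by
    rw [opening]
    by_cases hs : s = N.p t 1
    · rw [hs, Function.update_self]; simp
    · rw [Function.update_of_ne hs]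
      exact N.typed s
  dormant t' ht _ g hg := by
    have : g ≠ N.p t 1 := fun e => N.sep_gate t t' ht.symm (e ▸ hg)
    rw [opening, Function.update_of_ne this]
    exact N.guard t' g hg
  zone s _ hs := by rw [opening, Function.update_of_ne hs]
  gate := by rw [opening, Function.update_self]

/-- The opening of `t` has some value, at least `lb t`; every smaller ordinal is the value of a
position reachable from it. -/
theorem exists_value (lb : N.T → Ordinal.{0})
    (hlb : ∀ t, ∀ δ < lb t, ∃ k t', N.Next t k t' ∧ δ ≤ lb t')
    (hdark : ∀ s, N.B s ≠ none → Square.Dark s) (t : N.T) {α : Ordinal.{0}} (hα : α ≤ lb t) :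
    ∃ X : Position, X.OnDarkSquares ∧ X.HasGameValue .red α := by
  obtain ⟨γ, hγ⟩ := Ready.valued t _ (ready_opening t)
  refine Position.exists_of_le_value γ _ (fun s hs => hdark s fun hn => hs ?_) hγ α
    (hα.trans (Ready.atLeast lb hlb t _ (ready_opening t) γ hγ))
  simp only [opening]
  by_cases h : s = N.p t 1
  · rw [h, Function.update_self]
  · rw [Function.update_of_ne h, hn]

end Network

/-! ### Coordinates and the concrete board -/

/-- The dark squares are divided into parallelograms of 12 by 16 squares; this is the square with
coordinates `x` (towards the upper right) and `y` (towards the upper left) in the cell `(i, j)`. -/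
def sq (i j x y : ℤ) : Square := (6 * i - 16 * j + x - y, 18 * i + 16 * j + x + y)

/-- The column of the cell of a square. -/
def cellI (s : Square) : ℤ := (s.1 + s.2) / 2 / 12

/-- The row of the cell of a square. -/
def cellJ (s : Square) : ℤ := ((s.2 - s.1) / 2 - 6 * cellI s) / 16

/-- The first coordinate of a square in its cell. -/
def cellX (s : Square) : ℤ := (s.1 + s.2) / 2 % 12

/-- The second coordinate of a square in its cell. -/
def cellY (s : Square) : ℤ := ((s.2 - s.1) / 2 - 6 * cellI s) % 16

/-- The local coordinates `x`, `y` belong to a square of the cell itself. -/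
def InCell (x y : ℤ) : Prop := 0 ≤ x ∧ x < 12 ∧ 0 ≤ y ∧ y < 16

lemma cell_sq {i j x y : ℤ} (h : InCell x y) :
    cellI (sq i j x y) = i ∧ cellJ (sq i j x y) = j ∧ cellX (sq i j x y) = x ∧
      cellY (sq i j x y) = y := by
  obtain ⟨h1, h2, h3, h4⟩ := h
  have hI : cellI (sq i j x y) = i := by simp only [cellI, sq]; omega
  refine ⟨hI, ?_, ?_, ?_⟩
  · simp only [cellJ, hI]; simp only [sq]; omega
  · simp only [cellX, sq]; omega
  · simp only [cellY, hI]; simp only [sq]; omega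

lemma sq_cell {s : Square} (h : (s.1 + s.2) % 2 = 0) :
    s = sq (cellI s) (cellJ s) (cellX s) (cellY s) := by
  refine Prod.ext ?_ ?_ <;> simp only [sq, cellJ, cellX, cellY] <;> simp only [cellI] <;> omega

/-- The cells are sheared: the next column is shifted by 12 in `x` and 6 in `y`. Thus the point
`(12, 11)` where a row leaves a cell is the point `(0, 5)` where it enters the next. -/
lemma sq_eq_iff {i j x y i' j' x' y' : ℤ} : sq i j x y = sq i' j' x' y' ↔
    12 * i + x = 12 * i' + x' ∧ 6 * i + 16 * j + y = 6 * i' + 16 * j' + y' := by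
  simp only [sq, Prod.mk.injEq]
  omega

lemma sq_add_right (i j x y : ℤ) : sq i j x y + (1, 1) = sq i j (x + 1) y := by
  simp only [sq, Prod.mk_add_mk, Prod.mk.injEq]
  omega

lemma sq_add_left (i j x y : ℤ) : sq i j x y + (-1, 1) = sq i j x (y + 1) := by
  simp only [sq, Prod.mk_add_mk, Prod.mk.injEq]
  omega

lemma sq_sub_right (i j x y : ℤ) : sq i j x y - (1, 1) = sq i j (x - 1) y := by
  simp only [sq, Prod.mk_sub_mk, Prod.mk.injEq]
  omega

lemma sq_sub_left (i j x y : ℤ) : sq i j x y - (-1, 1) = sq i j x (y - 1) := by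
  simp only [sq, Prod.mk_sub_mk, Prod.mk.injEq]
  omega

lemma isGuard_sq {i j x y : ℤ} {s : Square} (h : IsGuard (sq i j x y) s) :
    ∃ dx dy : ℤ, s = sq i j (x + dx) (y + dy) ∧
      (dx = 0 ∧ (dy = 1 ∨ dy = 2 ∨ dy = -1) ∨ dy = 0 ∧ (dx = 1 ∨ dx = 2 ∨ dx = -1)) := by
  obtain ⟨e, rfl | rfl, rfl | rfl | rfl⟩ := h
  · exact ⟨1, 0, by rw [sq_add_right, add_zero], by simp⟩
  · exact ⟨2, 0, by rw [sq_add_right, sq_add_right, add_zero, add_assoc]; rfl, by simp⟩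
  · exact ⟨-1, 0, by rw [sq_sub_right, add_zero]; rfl, by simp⟩
  · exact ⟨0, 1, by rw [sq_add_left, add_zero], by simp⟩
  · exact ⟨0, 2, by rw [sq_add_left, sq_add_left, add_zero, add_assoc]; rfl, by simp⟩
  · exact ⟨0, -1, by rw [sq_sub_left, add_zero]; rfl, by simp⟩

/-- The squares that are initially empty. -/
def Vacant (i j x y : ℤ) : Prop :=
  0 ≤ j ∧ (i = j ∧ (x = 7 ∧ y % 2 = 0 ∧ y ≤ 10 ∨ x = 9 ∧ y = 11) ∨
    j < i ∧ (x = 0 ∧ (y = 5 ∨ y = 7 ∨ y = 9) ∨ y = 11 ∧ x % 2 = 0 ∨ y = 5 ∧ (x = 3 ∨ x = 5) ∨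
      x = 5 ∧ y = 7 ∨ x = 7 ∧ y % 2 = 0))

/-- The squares that may initially hold a black pawn. -/
def Waiting (i j x y : ℤ) : Prop :=
  0 ≤ j ∧ (i = j ∧ (x = 5 ∧ y = 11 ∨ x = 10 ∧ y = 9) ∨
    j < i ∧ (x = 1 ∧ y = 3 ∨ x = 3 ∧ y = 8))

open Classical in
/-- The initial board. The relation `R` tells which gates between rows and columns are armed. -/
noncomputable def board (R : ℕ → ℕ → Prop) : Board := fun s =>
  if (s.1 + s.2) % 2 = 0 then
    if Vacant (cellI s) (cellJ s) (cellX s) (cellY s) then none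
    -- Among the waiting squares only those of exits have `x = 1`; an unarmed exit gets a red pawn
    -- instead of a black one.
    else if Waiting (cellI s) (cellJ s) (cellX s) (cellY s) ∧
      (cellX s = 1 → R (cellI s).toNat (cellJ s).toNat) then some blackPawn
    else some redPawn
  else none

lemma sq_even (i j x y : ℤ) : ((sq i j x y).1 + (sq i j x y).2) % 2 = 0 := by
  simp only [sq]
  omega

lemma board_vacant {R : ℕ → ℕ → Prop} {i j x y : ℤ} (hc : InCell x y) (h : Vacant i j x y) :
    board R (sq i j x y) = none := by
  obtain ⟨h1, h2, h3, h4⟩ := cell_sq (i := i) (j := j) hc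
  rw [board, if_pos (sq_even _ _ _ _), h1, h2, h3, h4, if_pos h]

lemma board_ne_none {R : ℕ → ℕ → Prop} {i j x y : ℤ} (hc : InCell x y) (h : ¬ Vacant i j x y) :
    board R (sq i j x y) ≠ none := by
  obtain ⟨h1, h2, h3, h4⟩ := cell_sq (i := i) (j := j) hc
  rw [board, if_pos (sq_even _ _ _ _), h1, h2, h3, h4, if_neg h]
  split_ifs <;> simp

lemma board_red {R : ℕ → ℕ → Prop} {i j x y : ℤ} (hc : InCell x y) (h : ¬ Vacant i j x y)
    (hw : ¬ Waiting i j x y) : board R (sq i j x y) = some redPawn := by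
  obtain ⟨h1, h2, h3, h4⟩ := cell_sq (i := i) (j := j) hc
  rw [board, if_pos (sq_even _ _ _ _), h1, h2, h3, h4, if_neg h, if_neg (fun h => hw h.1)]

lemma board_black {R : ℕ → ℕ → Prop} {i j x y : ℤ} (hc : InCell x y)
    (hw : Waiting i j x y) (hR : x = 1 → R i.toNat j.toNat) :
    board R (sq i j x y) = some blackPawn := by
  obtain ⟨h1, h2, h3, h4⟩ := cell_sq (i := i) (j := j) hc
  have h : ¬ Vacant i j x y := by
    unfold Waiting at hw
    unfold Vacant
    omega
  rw [board, if_pos (sq_even _ _ _ _), h1, h2, h3, h4, if_neg h, if_pos ⟨hw, hR⟩]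

/-! ### The tracks and their geometry -/

/-- The tracks: a row `r`, the gadget by which the row `r` is left at the column `k`, the column `k`
from the row `r` upward, and the bend from the column `k` to the row `k`. -/
inductive Track
  | row (r : ℕ)
  | exit (k r : ℕ)
  | col (k r : ℕ)
  | bend (k : ℕ)

namespace Track

/-- The tracks that exist on the board. -/
def Present (R : ℕ → ℕ → Prop) : Track → Prop
  | row _ => True
  | exit k r => r < k ∧ R k r
  | col k r => r < k
  | bend _ => True

/-- The squares of a track. -/
def p : Track → ℕ → Square
  | row r, 0 => sq r r 10 9
  | row r, 1 => sq r r 10 11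
  -- A row crosses a cell in nine jumps: three raise `y` from 5 to 11, then six raise `x` from 0 to
  -- 12. Truncated subtraction keeps `x = 0` during the first three.
  | row r, n + 2 => sq (r + 1 + (n / 9 : ℕ)) r (2 * (n % 9 - 3 : ℕ)) (5 + 2 * (min (n % 9) 3 : ℕ))
  | exit k r, 0 => sq k r 1 3
  | exit k r, 1 => sq k r 1 5
  | exit k r, 2 => sq k r 3 5
  | exit k r, n + 3 => sq k r 5 (5 + 2 * n)
  | col k r, 0 => sq k r 3 8
  | col k r, 1 => sq k r 5 8
  | col k r, n + 2 => sq k r 7 (8 + 2 * n)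
  | bend k, n => sq k k (5 + 2 * n) 11

/-- The directions of the jumps of a track. -/
def d : Track → ℕ → Square
  | row _, 0 => (-1, 1)
  | row _, 1 => (1, 1)
  | row _, n + 2 => if n % 9 < 3 then (-1, 1) else (1, 1)
  | exit _ _, 0 => (-1, 1)
  | exit _ _, 1 => (1, 1)
  | exit _ _, 2 => (1, 1)
  | exit _ _, _ + 3 => (-1, 1)
  | col _ _, 0 => (1, 1)
  | col _ _, 1 => (1, 1)
  | col _ _, _ + 2 => (-1, 1)
  | bend _, _ => (1, 1)

/-- The jumps of a track that are possible. -/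
def ok : Track → ℕ → Prop
  | row _, _ => True
  | exit _ _, n => n < 4
  -- Two jumps lead to `x = 7`, and `8 * (k - r) + 1` more lead from `y = 8` in cell `(k, r)` to `y
  -- = 10` in cell `(k, k)`.
  | col k r, n => n < 8 * (k - r) + 3
  | bend _, n => n < 2

/-- The squares on which the use of a track depends. -/
def Zone : Track → ℤ → ℤ → ℤ → ℤ → Prop
  | row r, i, j, x, _ => r < i ∧ r ≤ j ∨ i = r ∧ j = r ∧ 10 ≤ x
  | exit k r, i, j, x, _ => k ≤ i ∧ r < j ∨ i = k ∧ j = r ∧ 1 ≤ x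
  | col k r, i, j, x, y => k ≤ i ∧ r < j ∨ i = k ∧ j = r ∧ 1 ≤ x ∧ 8 ≤ y
  | bend k, i, j, x, y => k < i ∧ k ≤ j ∨ i = k ∧ j = k ∧ (8 ≤ x ∨ 11 ≤ y)

/-- The coordinates of the pieces that can be jumped by the pawn of a track. -/
def MidAt : Track → ℤ → ℤ → ℤ → ℤ → Prop
  | row r, i, j, x, y => j = r ∧ (i = r ∧ (x = 10 ∧ y = 10 ∨ x = 11 ∧ y = 11) ∨
      r < i ∧ (x = 0 ∧ (y = 6 ∨ y = 8 ∨ y = 10) ∨ y = 11 ∧ x % 2 = 1))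
  | exit k r, i, j, x, y => i = k ∧ j = r ∧
      (x = 1 ∧ y = 4 ∨ x = 2 ∧ y = 5 ∨ x = 4 ∧ y = 5 ∨ x = 5 ∧ y = 6)
  | col k r, i, j, x, y => i = k ∧ (j = r ∧ y = 8 ∧ (x = 4 ∨ x = 6) ∨
      x = 7 ∧ y % 2 = 1 ∧ (r < j ∨ j = r ∧ 9 ≤ y) ∧ (j < k ∨ j = k ∧ y ≤ 9))
  | bend k, i, j, x, y => i = k ∧ j = k ∧ y = 11 ∧ (x = 6 ∨ x = 8)

/-- The coordinates of the pieces that can capture the pawn of a track. -/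
def HeadAt : Track → ℤ → ℤ → ℤ → ℤ → Prop
  | row r, i, j, x, y => j = r ∧ (i = r ∧ x = 10 ∧ y = 12 ∨
      r < i ∧ (x = 1 ∧ y = 5 ∨ x = 0 ∧ (y = 8 ∨ y = 10 ∨ y = 12) ∨ y = 11 ∧ x % 2 = 1 ∧ 3 ≤ x))
  | exit k r, i, j, x, y => i = k ∧ j = r ∧
      (x = 1 ∧ y = 6 ∨ x = 4 ∧ y = 5 ∨ x = 6 ∧ y = 5 ∨ x = 5 ∧ y = 8)
  | col k r, i, j, x, y => i = k ∧ (j = r ∧ y = 8 ∧ (x = 6 ∨ x = 8) ∨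
      x = 7 ∧ y % 2 = 1 ∧ (r < j ∨ j = r ∧ 11 ≤ y) ∧ (j < k ∨ j = k ∧ y ≤ 11))
  | bend k, i, j, x, y => i = k ∧ j = k ∧ y = 11 ∧ (x = 8 ∨ x = 10)

variable {R : ℕ → ℕ → Prop}

lemma isUp_d (t : Track) (n : ℕ) : IsUp (t.d n) := by
  unfold d
  split <;> try split_ifs
  all_goals simp [IsUp]

lemma p_succ (t : Track) (n : ℕ) : t.p (n + 1) = t.p n + t.d n + t.d n := by
  rcases t with r | ⟨k, r⟩ | ⟨k, r⟩ | k
  · rcases n with _ | _ | n <;> simp only [p, d]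
    · rw [sq_add_left, sq_add_left, sq_eq_iff]; omega
    · rw [sq_add_right, sq_add_right, sq_eq_iff]; omega
    · split_ifs
      · rw [sq_add_left, sq_add_left, sq_eq_iff]; omega
      · rw [sq_add_right, sq_add_right, sq_eq_iff]; omega
  · rcases n with _ | _ | _ | n <;> simp only [p, d]
    · rw [sq_add_left, sq_add_left, sq_eq_iff]; omega
    · rw [sq_add_right, sq_add_right, sq_eq_iff]; omega
    · rw [sq_add_right, sq_add_right, sq_eq_iff]; omega
    · rw [sq_add_left, sq_add_left, sq_eq_iff]; omega
  · rcases n with _ | _ | n <;> simp only [p, d]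
    · rw [sq_add_right, sq_add_right, sq_eq_iff]; omega
    · rw [sq_add_right, sq_add_right, sq_eq_iff]; omega
    · rw [sq_add_left, sq_add_left, sq_eq_iff]; omega
  · simp only [p, d]
    rw [sq_add_right, sq_add_right, sq_eq_iff]; omega

lemma ok_of_le {t : Track} {m n : ℕ} (h : t.ok n) (hm : m ≤ n) : t.ok m := by
  rcases t with r | ⟨k, r⟩ | ⟨k, r⟩ | k <;> simp only [ok] at h ⊢ <;> omega

lemma exists_mid {t : Track} (ht : t.Present R) {n : ℕ} (hn : t.ok n) :
    ∃ i j x y, t.p n + t.d n = sq i j x y ∧ InCell x y ∧ t.MidAt i j x y := by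
  rcases t with r | ⟨k, r⟩ | ⟨k, r⟩ | k
  · rcases n with _ | _ | n
    · exact ⟨r, r, 10, 10, by rw [p, d, sq_add_left]; rfl, by simp [InCell], by simp [MidAt]⟩
    · exact ⟨r, r, 11, 11, by rw [p, d, sq_add_right]; rfl, by simp [InCell], by simp [MidAt]⟩
    · simp only [p, d]
      split_ifs
      · exact ⟨_, _, _, _, sq_add_left _ _ _ _, by rw [InCell]; omega,
          by rw [MidAt]; omega⟩
      · exact ⟨_, _, _, _, sq_add_right _ _ _ _, by rw [InCell]; omega,
          by rw [MidAt]; omega⟩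
  · simp only [ok] at hn
    rcases n with _ | _ | _ | n
    · exact ⟨_, _, _, _, sq_add_left _ _ _ _, by simp [InCell], by simp [MidAt]⟩
    · exact ⟨_, _, _, _, sq_add_right _ _ _ _, by simp [InCell], by simp [MidAt]⟩
    · exact ⟨_, _, _, _, sq_add_right _ _ _ _, by simp [InCell], by simp [MidAt]⟩
    · exact ⟨_, _, _, _, sq_add_left _ _ _ _, by rw [InCell]; omega,
        by rw [MidAt]; omega⟩
  · simp only [ok] at hn
    simp only [Present] at ht
    rcases n with _ | _ | n
    · exact ⟨_, _, _, _, sq_add_right _ _ _ _, by simp [InCell], by simp [MidAt]⟩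
    · exact ⟨_, _, _, _, sq_add_right _ _ _ _, by simp [InCell], by simp [MidAt]⟩
    · refine ⟨k, r + (9 + 2 * n) / 16, 7, (9 + 2 * n) % 16, ?_, by rw [InCell]; omega,
        by rw [MidAt]; omega⟩
      rw [p, d, sq_add_left, sq_eq_iff]
      omega
  · simp only [ok] at hn
    exact ⟨_, _, _, _, sq_add_right _ _ _ _, by rw [InCell]; omega,
        by rw [MidAt]; omega⟩

lemma exists_head {t : Track} (ht : t.Present R) {n : ℕ} (hn : t.ok n) :
    ∃ i j x y, t.p (n + 1) + t.d n = sq i j x y ∧ InCell x y ∧ t.HeadAt i j x y := by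
  rcases t with r | ⟨k, r⟩ | ⟨k, r⟩ | k
  · rcases n with _ | _ | n
    · exact ⟨r, r, 10, 12, by rw [p, d, sq_add_left]; rfl, by simp [InCell], by simp [HeadAt]⟩
    · exact ⟨_, _, _, _, sq_add_right _ _ _ _, by simp [InCell], by simp [HeadAt]⟩
    · simp only [p, d]
      split_ifs
      · exact ⟨_, _, _, _, sq_add_left _ _ _ _, by rw [InCell]; omega,
          by rw [HeadAt]; omega⟩
      · exact ⟨_, _, _, _, sq_add_right _ _ _ _, by rw [InCell]; omega,
          by rw [HeadAt]; omega⟩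
  · simp only [ok] at hn
    rcases n with _ | _ | _ | n
    · exact ⟨_, _, _, _, sq_add_left _ _ _ _, by simp [InCell], by simp [HeadAt]⟩
    · exact ⟨_, _, _, _, sq_add_right _ _ _ _, by simp [InCell], by simp [HeadAt]⟩
    · exact ⟨_, _, _, _, sq_add_right _ _ _ _, by simp [InCell], by simp [HeadAt]⟩
    · exact ⟨_, _, _, _, sq_add_left _ _ _ _, by rw [InCell]; omega,
        by rw [HeadAt]; omega⟩
  · simp only [ok] at hn
    simp only [Present] at ht
    rcases n with _ | _ | n
    · exact ⟨_, _, _, _, sq_add_right _ _ _ _, by simp [InCell], by simp [HeadAt]⟩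
    · exact ⟨_, _, _, _, sq_add_right _ _ _ _, by simp [InCell], by simp [HeadAt]⟩
    · refine ⟨k, r + (11 + 2 * n) / 16, 7, (11 + 2 * n) % 16, ?_, by rw [InCell]; omega,
        by rw [HeadAt]; omega⟩
      rw [p, d, sq_add_left, sq_eq_iff]
      omega
  · simp only [ok] at hn
    exact ⟨_, _, _, _, sq_add_right _ _ _ _, by rw [InCell]; omega,
        by rw [HeadAt]; omega⟩

lemma MidAt.not_vacant {t : Track} (ht : t.Present R) {i j x y : ℤ} (hc : InCell x y)
    (h : t.MidAt i j x y) : ¬ Vacant i j x y ∧ ¬ Waiting i j x y ∧ t.Zone i j x y := by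
  rcases t with r | ⟨k, r⟩ | ⟨k, r⟩ | k <;>
    simp only [MidAt, Vacant, Waiting, Zone, InCell, Present] at * <;> omega

lemma HeadAt.not_vacant {t : Track} (ht : t.Present R) {i j x y : ℤ} (hc : InCell x y)
    (h : t.HeadAt i j x y) : ¬ Vacant i j x y ∧ ¬ Waiting i j x y ∧ t.Zone i j x y := by
  rcases t with r | ⟨k, r⟩ | ⟨k, r⟩ | k <;>
    simp only [HeadAt, Vacant, Waiting, Zone, InCell, Present] at * <;> omega

/-- The set of the squares on which the use of a track depends. -/
def Z (t : Track) : Set Square := {s | t.Zone (cellI s) (cellJ s) (cellX s) (cellY s)}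

lemma sq_mem_Z {t : Track} {i j x y : ℤ} (hc : InCell x y) :
    sq i j x y ∈ t.Z ↔ t.Zone i j x y := by
  obtain ⟨h1, h2, h3, h4⟩ := cell_sq (i := i) (j := j) hc
  rw [Z, Set.mem_ofPred_eq, h1, h2, h3, h4]

lemma exists_land {t : Track} (ht : t.Present R) {n : ℕ} (hn : t.ok (n + 1)) :
    ∃ i j x y, t.p (n + 2) = sq i j x y ∧ InCell x y ∧ Vacant i j x y ∧ t.Zone i j x y := by
  rcases t with r | ⟨k, r⟩ | ⟨k, r⟩ | k
  · exact ⟨_, _, _, _, rfl, by rw [InCell]; omega, by rw [Vacant]; omega,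
      by rw [Zone]; omega⟩
  · simp only [ok] at hn
    simp only [Present] at ht
    rcases n with _ | n
    · exact ⟨_, _, _, _, rfl, by rw [InCell]; omega, by rw [Vacant]; omega,
        by rw [Zone]; omega⟩
    · exact ⟨_, _, _, _, rfl, by rw [InCell]; omega, by rw [Vacant]; omega,
        by rw [Zone]; omega⟩
  · simp only [ok] at hn
    simp only [Present] at ht
    refine ⟨k, r + (8 + 2 * n) / 16, 7, (8 + 2 * n) % 16, ?_, by rw [InCell]; omega,
      by rw [Vacant]; omega, by rw [Zone]; omega⟩
    rw [p, sq_eq_iff]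
    omega
  · simp only [ok] at hn
    exact ⟨_, _, _, _, rfl, by rw [InCell]; omega, by rw [Vacant]; omega,
      by rw [Zone]; omega⟩

/-- In particular, at a crossing a pawn cannot turn from the row into the column or back: the two
tracks share the jumped piece at `(7, 11)` but no landing square. -/
lemma exists_side {t : Track} (ht : t.Present R) {n : ℕ} {e : Square} (hn : ∀ i < n, t.ok i)
    (he : IsUp e) (h : e ≠ t.d n ∨ ¬ t.ok n) :
    ∃ i j x y, t.p n + e + e = sq i j x y ∧ InCell x y ∧ ¬ Vacant i j x y ∧ t.Zone i j x y := by
  have hn' : n = 0 ∨ t.ok (n - 1) := by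
    rcases n with _ | n
    · simp
    · exact .inr (hn n (by omega))
  clear hn
  rcases t with r | ⟨k, r⟩ | ⟨k, r⟩ | k
  · rcases n with _ | _ | n
    · rcases he with rfl | rfl
      · refine ⟨r + 1, r, 0, 3, ?_, by rw [InCell]; omega, by rw [Vacant]; omega,
          by rw [Zone]; omega⟩
        rw [p, sq_add_right, sq_add_right, sq_eq_iff]
        omega
      · simp [d, ok] at h
    · rcases he with rfl | rfl
      · simp [d, ok] at h
      · refine ⟨r, r, 10, 13, ?_, by rw [InCell]; omega, by rw [Vacant]; omega,
          by rw [Zone]; omega⟩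
        rw [p, sq_add_left, sq_add_left, sq_eq_iff]
        omega
    · simp only [d, ok] at h
      simp only [p]
      rcases he with rfl | rfl
      · have : n % 9 < 3 := by by_contra hc; simp [hc] at h
        rw [sq_add_right, sq_add_right]
        exact ⟨_, _, _, _, rfl, by rw [InCell]; omega, by rw [Vacant]; omega,
          by rw [Zone]; omega⟩
      · have : ¬ n % 9 < 3 := by intro hc; simp [hc] at h
        rw [sq_add_left, sq_add_left]
        exact ⟨_, _, _, _, rfl, by rw [InCell]; omega, by rw [Vacant]; omega,
          by rw [Zone]; omega⟩
  · simp only [ok] at hn' h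
    simp only [Present] at ht
    rcases n with _ | _ | _ | n <;> rcases he with rfl | rfl <;> simp only [p, d] at h ⊢ <;>
      (first | rw [sq_add_right, sq_add_right] | rw [sq_add_left, sq_add_left]) <;>
      (try (exfalso; simp at h; done)) <;>
      refine ⟨_, _, _, _, rfl, by rw [InCell]; omega, ?_, ?_⟩ <;> (try simp at h) <;>
      (first | rw [Vacant] | rw [Zone]) <;> omega
  · simp only [ok] at hn' h
    simp only [Present] at ht
    rcases n with _ | _ | n
    · rcases he with rfl | rfl
      · simp [d] at h
      · rw [p, sq_add_left, sq_add_left]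
        exact ⟨_, _, _, _, rfl, by rw [InCell]; omega, by rw [Vacant]; omega,
          by rw [Zone]; omega⟩
    · rcases he with rfl | rfl
      · simp [d] at h
      · rw [p, sq_add_left, sq_add_left]
        exact ⟨_, _, _, _, rfl, by rw [InCell]; omega, by rw [Vacant]; omega,
          by rw [Zone]; omega⟩
    · rcases he with rfl | rfl
      · refine ⟨k, r + (8 + 2 * n) / 16, 9, (8 + 2 * n) % 16, ?_, by rw [InCell]; omega,
          by rw [Vacant]; omega, by rw [Zone]; omega⟩
        rw [p, sq_add_right, sq_add_right, sq_eq_iff]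
        omega
      · simp [d] at h
        -- A blocked jump straight on means that the column has ended, at `(7, 10)` of the diagonal
        -- cell.
        refine ⟨k, k, 7, 12, ?_, by rw [InCell]; omega,
          by rw [Vacant]; omega, by rw [Zone]; omega⟩
        rw [p, sq_add_left, sq_add_left, sq_eq_iff]
        omega
  · simp only [ok] at hn' h
    simp only [p, d] at h ⊢
    rcases he with rfl | rfl
    · simp at h
      rw [sq_add_right, sq_add_right]
      exact ⟨_, _, _, _, rfl, by rw [InCell]; omega, by rw [Vacant]; omega,
        by rw [Zone]; omega⟩
    · rw [sq_add_left, sq_add_left]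
      exact ⟨_, _, _, _, rfl, by rw [InCell]; omega, by rw [Vacant]; omega,
        by rw [Zone]; omega⟩

lemma not_vacant_guard {t : Track} (ht : t.Present R) {g : Square} (hg : IsGuard (t.p 0) g) :
    ∃ i j x y, g = sq i j x y ∧ InCell x y ∧ ¬ Vacant i j x y := by
  rcases t with r | ⟨k, r⟩ | ⟨k, r⟩ | k <;> obtain ⟨dx, dy, rfl, h⟩ := isGuard_sq hg <;>
    simp only [Present] at ht
  · by_cases hdx : dx = 2
    · refine ⟨r + 1, r, 0, 3, ?_, by rw [InCell]; omega, by rw [Vacant]; omega⟩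
      rw [sq_eq_iff]
      omega
    · exact ⟨_, _, _, _, rfl, by rw [InCell]; omega, by rw [Vacant]; omega⟩
  all_goals exact ⟨_, _, _, _, rfl, by rw [InCell]; omega, by rw [Vacant]; omega⟩

lemma sep_start {t t' : Track} (ht : t.Present R) (ht' : t'.Present R) :
    ¬ IsGuard (t'.p 0) (t.p 0) := by
  intro hg
  rcases t with r | ⟨k, r⟩ | ⟨k, r⟩ | k <;> rcases t' with r' | ⟨k', r'⟩ | ⟨k', r'⟩ | k' <;>
    obtain ⟨dx, dy, he, h⟩ := isGuard_sq hg <;> simp only [Present] at ht ht' <;>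
    simp only [p, sq_eq_iff] at he <;> omega

lemma sep_gate {t t' : Track} (hne : t ≠ t') (ht : t.Present R) (ht' : t'.Present R) :
    ¬ IsGuard (t'.p 0) (t.p 1) := by
  intro hg
  apply hne
  rcases t with r | ⟨k, r⟩ | ⟨k, r⟩ | k <;> rcases t' with r' | ⟨k', r'⟩ | ⟨k', r'⟩ | k' <;>
    obtain ⟨dx, dy, he, h⟩ := isGuard_sq hg <;> simp only [Present] at ht ht' <;>
    simp only [p, sq_eq_iff] at he <;>
    simp only [row.injEq, exit.injEq, col.injEq, bend.injEq, reduceCtorEq] <;> omega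

lemma sep_mid {t t' : Track} (hne : t ≠ t') (ht : t.Present R) (ht' : t'.Present R) {n : ℕ}
    (hn : t.ok n) : ¬ IsGuard (t'.p 0) (t.p n + t.d n) := by
  obtain ⟨i, j, x, y, e, hc, hm⟩ := exists_mid ht hn
  rw [e]
  intro hg
  apply hne
  simp only [InCell] at hc
  rcases t with r | ⟨k, r⟩ | ⟨k, r⟩ | k <;> rcases t' with r' | ⟨k', r'⟩ | ⟨k', r'⟩ | k' <;>
    obtain ⟨dx, dy, he, h⟩ := isGuard_sq hg <;> simp only [Present] at ht ht' <;>
    simp only [sq_eq_iff] at he <;> simp only [MidAt] at hm <;>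
    simp only [row.injEq, exit.injEq, col.injEq, bend.injEq, reduceCtorEq] <;> omega

lemma sep_head {t t' : Track} (hne : t ≠ t') (ht : t.Present R) (ht' : t'.Present R) {n : ℕ}
    (hn : t.ok n) (hg : IsGuard (t'.p 0) (t.p (n + 1) + t.d n)) :
    t'.p 1 = t.p (n + 1) + t.d n := by
  obtain ⟨i, j, x, y, e, hc, hm⟩ := exists_head ht hn
  rw [e] at hg ⊢
  simp only [InCell] at hc
  rcases t with r | ⟨k, r⟩ | ⟨k, r⟩ | k <;> rcases t' with r' | ⟨k', r'⟩ | ⟨k', r'⟩ | k' <;>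
    obtain ⟨dx, dy, he, h⟩ := isGuard_sq hg <;> simp only [Present] at ht ht' <;>
    simp only [ne_eq, row.injEq, exit.injEq, col.injEq, bend.injEq, reduceCtorEq] at hne <;>
    simp only [sq_eq_iff] at he <;> simp only [HeadAt] at hm <;>
    simp only [p, sq_eq_iff] <;> omega

/-- The gate of `t'` holds the piece that captures the pawn of `t` after `n + 1` jumps. -/
def Next (t : Track) (n : ℕ) (t' : Track) : Prop :=
  t.ok n ∧ t'.p 1 = t.p (n + 1) + t.d n

lemma Next.cases {t t' : Track} (ht : t.Present R) (ht' : t'.Present R) {n : ℕ}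
    (h : t.Next n t') : (∃ k r, t = row r ∧ t' = exit k r) ∨
      (∃ k r, t = exit k r ∧ t' = col k r) ∨ (∃ k r, t = col k r ∧ t' = bend k) ∨
      ∃ k, t = bend k ∧ t' = row k := by
  obtain ⟨i, j, x, y, e, hc, hm⟩ := exists_head ht h.1
  have h2 := h.2
  rw [e] at h2
  simp only [InCell] at hc
  rcases t with r | ⟨k, r⟩ | ⟨k, r⟩ | k <;> rcases t' with r' | ⟨k', r'⟩ | ⟨k', r'⟩ | k' <;>
    simp only [Present] at ht ht' <;>
    simp only [HeadAt] at hm <;> simp only [p, sq_eq_iff] at h2 <;>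
    simp only [row.injEq, exit.injEq, col.injEq, bend.injEq, reduceCtorEq, false_and, and_false,
      exists_false, false_or, or_false]
  case row.exit => exact ⟨k', r', by omega, rfl, rfl⟩
  case exit.col => exact ⟨k', r', by omega, rfl, rfl⟩
  case col.bend => exact ⟨k', r, by omega, rfl⟩
  case bend.row => exact ⟨r', by omega, rfl⟩
  all_goals omega

lemma p_snd (t : Track) (n : ℕ) : (t.p n).2 = (t.p 0).2 + 2 * n := by
  induction n with
  | zero => simp
  | succ k ih =>
    rw [p_succ, Prod.snd_add, Prod.snd_add, ih, (t.isUp_d k).snd]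
    push_cast
    ring

lemma sq_snd (i j x y : ℤ) : (sq i j x y).2 = 18 * i + 16 * j + x + y := rfl

/-- Using a track destroys the crossings it passes, but these lie to the left of or below everything
that later tracks need. -/
lemma Next.not_zone_mid {t t' : Track} (ht : t.Present R) (ht' : t'.Present R) {n : ℕ}
    (h : t.Next n t') {m : ℕ} (hm : m ≤ n) (hok : t.ok m) : t.p m + t.d m ∉ t'.Z := by
  obtain ⟨i, j, x, y, e, hc, hM⟩ := exists_mid ht hok
  -- `MidAt` describes the whole track; comparing heights discards the part beyond the stop.
  have hlt : (t.p m + t.d m).2 < (t'.p 1).2 := by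
    rw [h.2, Prod.snd_add, Prod.snd_add, (t.isUp_d m).snd, (t.isUp_d n).snd, p_snd, p_snd t (n + 1)]
    push_cast
    omega
  rw [e] at hlt ⊢
  rw [sq_mem_Z hc]
  simp only [InCell] at hc
  rcases h.cases ht ht' with ⟨k, r, rfl, rfl⟩ | ⟨k, r, rfl, rfl⟩ | ⟨k, r, rfl, rfl⟩ |
    ⟨k, rfl, rfl⟩ <;>
    simp only [Present] at ht ht' <;> simp only [MidAt] at hM <;> simp only [p, sq_snd] at hlt <;>
    simp only [Zone] <;> omega

/-- The stops at which the pawn of a track is captured by a gate. -/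
def StopAt : Track → Track → Square → Square → Prop
  | row r, exit k r', s, e => r' = r ∧ s = sq k r 0 5 ∧ e = (1, 1)
  | exit k r, col k' r', s, e => k' = k ∧ r' = r ∧ s = sq k r 5 7 ∧ e = (-1, 1)
  | col k _, bend k', s, e => k' = k ∧ s = sq k k 7 10 ∧ e = (-1, 1)
  | bend k, row r, s, e => r = k ∧ s = sq k k 9 11 ∧ e = (1, 1)
  | _, _, _, _ => False

lemma Next.stopAt {t t' : Track} (ht : t.Present R) (ht' : t'.Present R) {n : ℕ}
    (h : t.Next n t') : StopAt t t' (t.p (n + 1)) (t.d n) := by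
  have hc := h.cases ht ht'
  obtain ⟨hok, h⟩ := h
  rcases hc with ⟨k, r, rfl, rfl⟩ | ⟨k, r, rfl, rfl⟩ | ⟨k, r, rfl, rfl⟩ |
    ⟨k, rfl, rfl⟩ <;>
    simp only [Present] at ht ht' <;> simp only [ok] at hok <;> simp only [StopAt, true_and]
  · rcases n with _ | _ | n <;> simp only [p, d] at h ⊢
    · rw [sq_add_left, sq_eq_iff] at h
      omega
    · rw [sq_add_right, sq_eq_iff] at h
      rw [sq_eq_iff]
      exact ⟨by omega, trivial⟩
    · split_ifs at h ⊢
      · rw [sq_add_left, sq_eq_iff] at h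
        omega
      · rw [sq_add_right, sq_eq_iff] at h
        rw [sq_eq_iff]
        exact ⟨by omega, rfl⟩
  · rcases n with _ | _ | _ | n <;> simp only [p, d] at h ⊢
    · rw [sq_add_left, sq_eq_iff] at h
      omega
    · rw [sq_add_right, sq_eq_iff] at h
      omega
    · rw [sq_add_right, sq_eq_iff] at h
      omega
    · rw [sq_eq_iff]
      exact ⟨by omega, trivial⟩
  · rcases n with _ | _ | n <;> simp only [p, d] at h ⊢
    · rw [sq_add_right, sq_eq_iff] at h
      omega
    · rw [sq_add_right, sq_eq_iff] at h
      omega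
    · rw [sq_add_left, sq_eq_iff] at h
      rw [sq_eq_iff]
      exact ⟨by omega, trivial⟩
  · simp only [p, d] at h ⊢
    rw [sq_add_right, sq_eq_iff] at h
    rw [sq_eq_iff]
    exact ⟨by omega, trivial⟩

lemma Next.not_zone_p {t t' : Track} (ht : t.Present R) (ht' : t'.Present R) {n : ℕ}
    (h : t.Next n t') : t.p 0 ∉ t'.Z ∧ t.p 1 ∉ t'.Z ∧ t.p (n + 1) ∉ t'.Z := by
  have hs := h.stopAt ht ht'
  rcases h.cases ht ht' with ⟨k, r, rfl, rfl⟩ | ⟨k, r, rfl, rfl⟩ | ⟨k, r, rfl, rfl⟩ |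
    ⟨k, rfl, rfl⟩ <;>
    simp only [Present] at ht ht' <;> simp only [StopAt, true_and] at hs <;> rw [hs.1] <;>
    simp only [p] <;>
    rw [sq_mem_Z (by rw [InCell]; omega), sq_mem_Z (by rw [InCell]; omega),
      sq_mem_Z (by rw [InCell]; omega)] <;> simp only [Zone] <;> omega

lemma Next.zone_subset {t t' : Track} (ht : t.Present R) (ht' : t'.Present R) {n : ℕ}
    (h : t.Next n t') : t'.Z ⊆ t.Z := by
  intro s
  simp only [Z, Set.mem_ofPred_eq]
  generalize cellI s = i
  generalize cellJ s = j
  generalize cellX s = x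
  generalize cellY s = y
  intro hs
  rcases h.cases ht ht' with ⟨k, r, rfl, rfl⟩ | ⟨k, r, rfl, rfl⟩ | ⟨k, r, rfl, rfl⟩ |
    ⟨k, rfl, rfl⟩ <;>
    simp only [Present] at ht ht' <;> simp only [Zone] at hs ⊢ <;> omega

lemma Next.unique {t t' : Track} (ht : t.Present R) (ht' : t'.Present R) {n : ℕ}
    (h : t.Next n t') {e : Square} (he : IsUp e) (hne : e ≠ t.d n) :
    ∃ i j x y, t.p (n + 1) - e = sq i j x y ∧ InCell x y ∧ ¬ Vacant i j x y ∧
      t.Zone i j x y := by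
  have hs := h.stopAt ht ht'
  rcases h.cases ht ht' with ⟨k, r, rfl, rfl⟩ | ⟨k, r, rfl, rfl⟩ | ⟨k, r, rfl, rfl⟩ |
    ⟨k, rfl, rfl⟩ <;>
    simp only [Present] at ht ht' <;> simp only [StopAt, true_and] at hs <;> rw [hs.2] at hne <;>
    rw [hs.1] <;> rcases he with rfl | rfl
  · exact absurd rfl hne
  · rw [sq_sub_left]
    exact ⟨_, _, _, _, rfl, by rw [InCell]; omega, by rw [Vacant]; omega, by rw [Zone]; omega⟩
  · rw [sq_sub_right]
    exact ⟨_, _, _, _, rfl, by rw [InCell]; omega, by rw [Vacant]; omega, by rw [Zone]; omega⟩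
  · exact absurd rfl hne
  · rw [sq_sub_right]
    exact ⟨_, _, _, _, rfl, by rw [InCell]; omega, by rw [Vacant]; omega, by rw [Zone]; omega⟩
  · exact absurd rfl hne
  · exact absurd rfl hne
  · rw [sq_sub_left]
    exact ⟨_, _, _, _, rfl, by rw [InCell]; omega, by rw [Vacant]; omega, by rw [Zone]; omega⟩

lemma start_black {t : Track} (ht : t.Present R) :
    t.p 0 ∈ t.Z ∧ board R (t.p 0) = some blackPawn := by
  rcases t with r | ⟨k, r⟩ | ⟨k, r⟩ | k <;> simp only [Present] at ht <;> simp only [p]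
  all_goals refine ⟨(sq_mem_Z (by rw [InCell]; omega)).2 (by rw [Zone]; omega),
    board_black (by rw [InCell]; omega) (by rw [Waiting]; omega) fun hx => ?_⟩
  · omega
  · simpa using ht.2
  · omega
  · omega

lemma board_typed (s : Square) : board R s = none ∨ board R s = some redPawn ∨
    ∃ t : Track, t.Present R ∧ s = t.p 0 ∧ board R s = some blackPawn := by
  by_cases he : (s.1 + s.2) % 2 = 0
  swap
  · exact .inl (by rw [board, if_neg he])
  by_cases hv : Vacant (cellI s) (cellJ s) (cellX s) (cellY s)
  · exact .inl (by rw [board, if_pos he, if_pos hv])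
  by_cases hw : Waiting (cellI s) (cellJ s) (cellX s) (cellY s) ∧
      (cellX s = 1 → R (cellI s).toNat (cellJ s).toNat)
  swap
  · exact .inr (.inl (by rw [board, if_pos he, if_neg hv, if_neg hw]))
  have hb : board R s = some blackPawn := by rw [board, if_pos he, if_neg hv, if_pos hw]
  simp only [hb, and_true]
  refine .inr (.inr ?_)
  obtain ⟨hw, hR⟩ := hw
  have hs := sq_cell he
  revert hw hR hs
  generalize cellI s = i
  generalize cellJ s = j
  generalize cellX s = x
  generalize cellY s = y
  rintro ⟨hj, h⟩ hR rfl
  obtain ⟨k, rfl⟩ : ∃ k : ℕ, i = k := ⟨i.toNat, by omega⟩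
  obtain ⟨r, rfl⟩ : ∃ r : ℕ, j = r := ⟨j.toNat, by omega⟩
  rcases h with ⟨h, ⟨rfl, rfl⟩ | ⟨rfl, rfl⟩⟩ | ⟨h, ⟨rfl, rfl⟩ | ⟨rfl, rfl⟩⟩
  · exact ⟨bend k, trivial, by rw [p, sq_eq_iff]; omega⟩
  · exact ⟨row k, trivial, by rw [p, sq_eq_iff]; omega⟩
  · exact ⟨exit k r, ⟨by omega, by simpa using hR⟩, rfl⟩
  · exact ⟨col k r, by rw [Present]; omega, rfl⟩

lemma spare {t : Track} (ht : t.Present R) (h : ∀ n, t.ok n) :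
    ∃ n, (∀ t' : Track, t'.Present R → ¬ t.Next n t') ∧ ∀ i, t.p (n + 1) + t.d n ≠ t.p i + t.d i := by
  rcases t with r | ⟨k, r⟩ | ⟨k, r⟩ | k
  -- After its first jump the row turns, so the red pawn ahead is not jumped next; and rows are left
  -- only at stops reached in direction `(1, 1)`.
  · refine ⟨0, fun t' ht' hn => ?_, fun i hi => ?_⟩
    · have hs := hn.stopAt ht ht'
      rcases hn.cases ht ht' with ⟨k, r', h1, rfl⟩ | ⟨k, r', h1, -⟩ | ⟨k, r', h1, -⟩ | ⟨k, h1, -⟩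
      · simp [StopAt, d] at hs
      all_goals simp at h1
    · obtain ⟨a, b, x, y, e, hc, hm⟩ := exists_mid ht (h i)
      rw [e] at hi
      simp only [p, d] at hi
      rw [sq_add_left, sq_eq_iff] at hi
      simp only [MidAt] at hm
      simp only [InCell] at hc
      omega
  · exact absurd (h 4) (by simp [ok])
  · exact absurd (h (8 * (k - r) + 3)) (by simp [ok])
  · exact absurd (h 2) (by simp [ok])

/-! ### The network labelled by ordinals -/

/-- The number of gates on the way from a track to the next row. -/
def stage : Track → ℕ
  | row _ => 0
  | bend _ => 1
  | col _ _ => 2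
  | exit _ _ => 3

/-- The number of the row to which a track leads. -/
def target : Track → ℕ
  | row r => r
  | exit k _ => k
  | col k _ => k
  | bend k => k

/-- Jump `9 * q + 1` lands on `(0, 5)` of the cell in column `r + 1 + q`, where the row turns and
the pawn ahead is the gate of the exit. -/
lemma next_exit (r q : ℕ) : (row r).Next (9 * q + 1) (exit (r + 1 + q) r) := by
  refine ⟨trivial, ?_⟩
  have hd : (row r).d (9 * q + 1) = (1, 1) := by
    rcases q with _ | q
    · rfl
    · rw [show 9 * (q + 1) + 1 = (9 * q + 8) + 2 by ring, d, if_neg (by omega)]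
  rw [hd, p, p, sq_add_right, sq_eq_iff]
  push_cast
  omega

lemma next_col (k r : ℕ) : (exit k r).Next 3 (col k r) :=
  ⟨by simp [ok], by rw [p, p, d, sq_add_left, sq_eq_iff]; omega⟩

lemma next_bend {k r : ℕ} (h : r < k) : (col k r).Next (8 * (k - r) + 2) (bend k) :=
  ⟨by simp [ok], by rw [p, p, d, sq_add_left, sq_eq_iff]; omega⟩

lemma next_row (k : ℕ) : (bend k).Next 1 (row k) :=
  ⟨by simp [ok], by rw [p, p, d, sq_add_right, sq_eq_iff]; omega⟩

/-- The network in which the rows are labelled by ordinals, and in which it is possible to go from a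
row to each later row with a smaller label. -/
noncomputable def network (f : ℕ → Ordinal.{0}) : Network where
  T := {t : Track // t.Present fun k r => f k < f r}
  B := board fun k r => f k < f r
  p t := t.1.p
  d t := t.1.d
  ok t := t.1.ok
  Z t := t.1.Z
  Next t n t' := t.1.Next n t'.1
  up t := t.1.isUp_d
  p_succ t := t.1.p_succ
  ok_zero := by rintro ⟨t | t | t | t, -⟩ <;> simp [ok]
  ok_of_succ t n h := ok_of_le h n.le_succ
  typed s := by
    rcases board_typed (R := fun k r => f k < f r) s with h | h | ⟨t, ht, h⟩
    · exact .inl h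
    · exact .inr (.inl h)
    · exact .inr (.inr ⟨⟨t, ht⟩, h⟩)
  start t := start_black t.2
  mid t n hn := by
    obtain ⟨i, j, x, y, e, hc, hm⟩ := exists_mid t.2 hn
    obtain ⟨h1, h2, h3⟩ := hm.not_vacant t.2 hc
    rw [e]
    exact ⟨(sq_mem_Z hc).2 h3, board_red hc h1 h2⟩
  land t n hn := by
    obtain ⟨i, j, x, y, e, hc, hv, hz⟩ := exists_land t.2 hn
    rw [e]
    exact ⟨(sq_mem_Z hc).2 hz, board_vacant hc hv⟩
  head t n hn := by
    obtain ⟨i, j, x, y, e, hc, hm⟩ := exists_head t.2 hn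
    obtain ⟨h1, h2, h3⟩ := hm.not_vacant t.2 hc
    rw [e]
    exact ⟨(sq_mem_Z hc).2 h3, board_red hc h1 h2⟩
  side t n e hn he h := by
    obtain ⟨i, j, x, y, e, hc, hv, hz⟩ := exists_side t.2 hn he h
    rw [e]
    exact ⟨(sq_mem_Z hc).2 hz, board_ne_none hc hv⟩
  guard t g hg := by
    obtain ⟨i, j, x, y, rfl, hc, hv⟩ := not_vacant_guard t.2 hg
    exact board_ne_none hc hv
  sep_start t t' _ := sep_start t.2 t'.2
  sep_gate t t' hne := sep_gate (fun h => hne (Subtype.ext h)) t.2 t'.2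
  sep_mid t t' n hne hn := sep_mid (fun h => hne (Subtype.ext h)) t.2 t'.2 hn
  sep_head t t' n hne hn hg := ⟨hn, sep_head (fun h => hne (Subtype.ext h)) t.2 t'.2 hn hg⟩
  next_ok t n t' h := h.1
  next_gate t n t' h := h.2
  next_zone t n t' h s hs _ := by
    obtain ⟨h1, h2, h3⟩ := h.not_zone_p t.2 t'.2
    refine ⟨h.zone_subset t.2 t'.2 hs, fun e => h1 (e ▸ hs), fun e => h2 (e ▸ hs),
      fun e => h3 (e ▸ hs), fun i hi e => ?_⟩
    exact h.not_zone_mid t.2 t'.2 hi (ok_of_le h.1 hi) (e ▸ hs)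
  next_unique t n t' e h he hne := by
    obtain ⟨i, j, x, y, e, hc, hv, hz⟩ := h.unique t.2 t'.2 he hne
    rw [e]
    exact ⟨(sq_mem_Z hc).2 hz, board_ne_none hc hv⟩
  spare t h := by
    obtain ⟨n, h1, h2⟩ := spare t.2 h
    exact ⟨n, fun t' => h1 t'.1 t'.2, h2⟩
  wf := by
    -- Taking an exit lowers the label of the target row; the other transitions keep the target and
    -- lower the stage.
    refine Subrelation.wf (r := InvImage (Prod.Lex (· < ·) (· < ·))
      fun t : {t : Track // t.Present fun k r => f k < f r} => (f t.1.target, t.1.stage)) ?_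
      (InvImage.wf _ (WellFounded.prod_lex wellFounded_lt wellFounded_lt))
    rintro ⟨t', ht'⟩ ⟨t, ht⟩ ⟨n, h⟩
    simp only [InvImage]
    simp only at h
    rcases h.cases ht ht' with ⟨k, r, rfl, rfl⟩ | ⟨k, r, rfl, rfl⟩ | ⟨k, r, rfl, rfl⟩ |
      ⟨k, rfl, rfl⟩
    · exact .left _ _ ht'.2
    all_goals exact .right _ (by simp [stage])

lemma exists_next (f : ℕ → Ordinal.{0}) (hf : ∀ r, ∀ δ < f r, ∃ k, r < k ∧ f k = δ)
    (t : (network f).T) (δ : Ordinal.{0}) (hδ : δ < f t.1.target) :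
    ∃ n t', (network f).Next t n t' ∧ δ ≤ f t'.1.target := by
  obtain ⟨t, ht⟩ := t
  rcases t with r | ⟨k, r⟩ | ⟨k, r⟩ | k
  · obtain ⟨k, hk, rfl⟩ := hf r δ hδ
    obtain ⟨q, rfl⟩ : ∃ q, k = r + 1 + q := ⟨k - (r + 1), by omega⟩
    exact ⟨_, ⟨exit (r + 1 + q) r, hk, hδ⟩, next_exit r q, le_rfl⟩
  · exact ⟨_, ⟨col k r, ht.1⟩, next_col k r, hδ.le⟩
  · exact ⟨_, ⟨bend k, trivial⟩, next_bend ht, hδ.le⟩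
  · exact ⟨_, ⟨row k, trivial⟩, next_row k, hδ.le⟩

end Track

/-! ### The sequence of labels and the conclusion -/

/-- Every countable ordinal is the first one in a sequence of ordinals in which every ordinal below
an entry occurs after that entry. -/
lemma exists_ordinal_sequence (α : Ordinal.{0}) (hα : α.card ≤ ℵ₀) :
    ∃ f : ℕ → Ordinal.{0}, f 0 = α ∧ ∀ r, ∀ δ < f r, ∃ k, r < k ∧ f k = δ := by
  have hc : (Set.Iio α).Countable := by
    rw [← Cardinal.le_aleph0_iff_set_countable, Cardinal.mk_Iio_ordinal]
    exact Cardinal.lift_le_aleph0.2 hα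
  rcases (Set.Iio α).eq_empty_or_nonempty with he | hne
  · refine ⟨fun _ => α, rfl, fun r δ hδ => ?_⟩
    exact absurd (show δ ∈ Set.Iio α from hδ) (he ▸ Set.notMem_empty δ)
  obtain ⟨g, hg⟩ := hc.exists_eq_range hne
  refine ⟨fun r => if r = 0 then α else g r.unpair.1, rfl, fun r δ hδ => ?_⟩
  have hlt : δ < α := by
    simp only at hδ
    split_ifs at hδ
    · exact hδ
    · have : g r.unpair.1 ∈ Set.Iio α := hg ▸ Set.mem_range_self _
      exact hδ.trans this
  obtain ⟨n, rfl⟩ : δ ∈ Set.range g := hg ▸ hlt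
  have hle := Nat.right_le_pair n (r + 1)
  -- Unpairing repeats each `g n` infinitely often; the second component `r + 1` forces the index
  -- beyond `r`.
  refine ⟨Nat.pair n (r + 1), by omega, ?_⟩
  simp only
  rw [if_neg (by omega), Nat.unpair_pair]

lemma board_dark (R : ℕ → ℕ → Prop) (s : Square) (hs : board R s ≠ none) : Square.Dark s := by
  rw [Square.Dark, Int.even_iff]
  by_contra h
  exact hs (by rw [board, if_neg h])

end Draughts

/-- In infinite draughts with the forced-jump rule, but without the forced-iterated-jump rule, every
countable ordinal is the game value (for Red) of some position. -/
theorem theorem2 (α : Ordinal.{0}) (hα : α.card ≤ ℵ₀) :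
    ∃ X : Draughts.Position, X.OnDarkSquares ∧
      Draughts.Position.HasGameValue Draughts.Player.red α X := by
  obtain ⟨f, rfl, hf⟩ := Draughts.exists_ordinal_sequence α hα
  exact (Draughts.Track.network f).exists_value (fun t => f t.1.target)
    (Draughts.Track.exists_next f hf) (Draughts.board_dark fun k r => f k < f r)
    ⟨.row 0, trivial⟩ le_rfl
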